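/- For measurable $f_1,f_2:\mathbb R\to\mathbb C$ let $$T(f_1,f_2)(x)=\int_0^{2\pi} f_1(x-\cos t)\,f_2(x-\sin t)\,dt,\qquad x\in\mathbb R .$$ For $1\le p_1,p_2,r\le\infty$ we say that, at the point $\left(\frac1{p_1},\frac1{p_2};\frac1r\right)$, the operator $T$ is of *strong type* if it is bounded $L^{p_1}(\mathbb R)\times L^{p_2}(\mathbb R)\to L^r(\mathbb R)$; of *restricted type* if it is bounded $L^{p_1,1}(\mathbb R)\times L^{p_2,1}(\mathbb R)\to L^r(\mathbb R)$; and of *weak type* if it is bounded $L^{p_1}(\mathbb R)\times L^{p_2}(\mathbb R)\to L^{r,\infty}(\mathbb R)$. Here $\|f\|_{L^{p,1}}=p\int_0^\infty |\{|f|>s\}|^{1/p}\,ds$ for $p<\infty$, with $L^{p,1}$ read as $L^\infty$ when $p=\infty$, and $\|f\|_{L^{p,\infty}}=\sup_{s>0}s\,|\{|f|>s\}|^{1/p}$ for $p<\infty$. Bounded means that, for all $f_1,f_2$ in the given spaces, the integral defining $T(f_1,f_2)(x)$ converges absolutely for almost every $x$, the function $T(f_1,f_2)$ is measurable, and its norm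 is at most a constant (independent of $f_1,f_2$) times the product of the norms of $f_1$ and $f_2$. We say that strong type *fails* at a point if no constant $c$ satisfies $\|T(f_1,f_2)\|_{L^r}\le c\,\|f_1\|_{L^{p_1}}\|f_2\|_{L^{p_2}}$ for all continuous compactly supported $f_1,f_2$ (in particular, $T$ is then not of strong type there). Let $O=(0,0;0)$, $C=(0,1;1)$, $M=(\frac35,\frac35;\frac25)$, $P=(\frac12,1;1)$, $G=(\frac13,1;\frac23)$, $E=(0,\frac12;0)$, $B=(\frac13,\frac13;0)$, $K=(0,1;\frac12)$. Then: 1. $T$ is of strong type at $O$, $C$ and $M$. 2. $T$ is of restricted type at $P$, $G$, $E$ and $B$, and strong type fails at each of these four points. 3. $T$ is of weak type at $K$, that is, bounded $L^\infty\times L^1\to L^{2,\infty}$, and strong type fails at $K$. 4. Strong type fails at every point of the open line segment joining $B$ and $E$. -/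

import Mathlib

open MeasureTheory
open scoped ENNReal NNReal

noncomputable section

namespace CircularBilinear

/-- The integrand `t ↦ f₁ (x - cos t) f₂ (x - sin t)`. -/
def integrand (f₁ f₂ : ℝ → ℂ) (x t : ℝ) : ℂ :=
  f₁ (x - Real.cos t) * f₂ (x - Real.sin t)

/-- The operator `T(f₁, f₂)(x) = ∫_0^{2π} f₁(x - cos t) f₂(x - sin t) dt`. -/
def T (f₁ f₂ : ℝ → ℂ) (x : ℝ) : ℂ :=
  ∫ t in (0 : ℝ)..(2 * Real.pi), integrand f₁ f₂ x t

/-- The distribution function `d_f(s) = |{x : |f x| > s}|`. -/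
def distrib (f : ℝ → ℂ) (s : ℝ) : ℝ≥0∞ :=
  volume {x : ℝ | s < ‖f x‖}

/-- The Lorentz `L^{p,1}` quasinorm `p ∫_0^∞ d_f(s)^{1/p} ds` for `1 ≤ p < ∞`
(this equals `∫_0^∞ t^{1/p} f^*(t) dt / t`).  For `p = ∞` it is the `L^∞` norm, the
usual convention for restricted type estimates. -/
def lorentzOneNorm (p : ℝ≥0∞) (f : ℝ → ℂ) : ℝ≥0∞ :=
  if p = ∞ then eLpNorm f ∞ volume
  else p * ∫⁻ s in Set.Ioi (0 : ℝ), distrib f s ^ (1 / p.toReal)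

/-- The weak Lebesgue quasinorm `‖f‖_{L^{p,∞}} = sup_{s > 0} s d_f(s)^{1/p}` for
`1 ≤ p < ∞`, and the `L^∞` norm for `p = ∞`. -/
def weakNorm (p : ℝ≥0∞) (f : ℝ → ℂ) : ℝ≥0∞ :=
  if p = ∞ then eLpNorm f ∞ volume
  else ⨆ s : Set.Ioi (0 : ℝ), ENNReal.ofReal s * distrib f s ^ (1 / p.toReal)

/-- `T` is bounded from the space of measurable functions with finite `N₁` times the space
of those with finite `N₂` to the space given by `N`: the integral defining `T(f₁, f₂)(x)`
converges absolutely for almost every `x`, it is a measurable function of `x`, and the norm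
estimate holds with a constant that does not depend on `f₁, f₂`. -/
def IsBoundedBetween (N₁ N₂ N : (ℝ → ℂ) → ℝ≥0∞) : Prop :=
  ∃ C : ℝ≥0, ∀ f₁ f₂ : ℝ → ℂ,
    AEStronglyMeasurable f₁ volume → AEStronglyMeasurable f₂ volume →
    N₁ f₁ < ∞ → N₂ f₂ < ∞ →
      (∀ᵐ x : ℝ, IntervalIntegrable (integrand f₁ f₂ x) volume 0 (2 * Real.pi)) ∧
      AEStronglyMeasurable (T f₁ f₂) volume ∧
      N (T f₁ f₂) ≤ C * N₁ f₁ * N₂ f₂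

/-- Strong type at `(1/p₁, 1/p₂; 1/r)`: `T : L^{p₁} × L^{p₂} → L^r`. -/
def IsStrongType (p₁ p₂ r : ℝ≥0∞) : Prop :=
  IsBoundedBetween (fun f => eLpNorm f p₁ volume) (fun f => eLpNorm f p₂ volume)
    (fun f => eLpNorm f r volume)

/-- Restricted type at `(1/p₁, 1/p₂; 1/r)`: `T : L^{p₁,1} × L^{p₂,1} → L^r`. -/
def IsRestrictedType (p₁ p₂ r : ℝ≥0∞) : Prop :=
  IsBoundedBetween (lorentzOneNorm p₁) (lorentzOneNorm p₂) (fun f => eLpNorm f r volume)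

/-- Weak type at `(1/p₁, 1/p₂; 1/r)`: `T : L^{p₁} × L^{p₂} → L^{r,∞}`. -/
def IsWeakType (p₁ p₂ r : ℝ≥0∞) : Prop :=
  IsBoundedBetween (fun f => eLpNorm f p₁ volume) (fun f => eLpNorm f p₂ volume)
    (weakNorm r)

/-- The strong type estimate at `(1/p₁, 1/p₂; 1/r)` required only for continuous compactly
supported functions, for which `T` is defined everywhere.  It is implied by strong type, so
its failure is the strongest form of failure of strong type. -/
def IsStrongTypeOnTest (p₁ p₂ r : ℝ≥0∞) : Prop :=
  ∃ C : ℝ≥0, ∀ f₁ f₂ : ℝ → ℂ,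
    Continuous f₁ → HasCompactSupport f₁ → Continuous f₂ → HasCompactSupport f₂ →
      eLpNorm (T f₁ f₂) r volume ≤ C * eLpNorm f₁ p₁ volume * eLpNorm f₂ p₂ volume

theorem IsStrongType.onTest {p₁ p₂ r : ℝ≥0∞} (h : IsStrongType p₁ p₂ r) :
    IsStrongTypeOnTest p₁ p₂ r := by
  obtain ⟨C, hC⟩ := h
  refine ⟨C, fun f₁ f₂ h₁ k₁ h₂ k₂ => ?_⟩
  have m₁ : MemLp f₁ p₁ volume := h₁.memLp_of_hasCompactSupport k₁
  have m₂ : MemLp f₂ p₂ volume := h₂.memLp_of_hasCompactSupport k₂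
  exact (hC f₁ f₂ m₁.1 m₂.1 m₁.2 m₂.2).2.2

/-- Failure of the estimate on test functions implies failure of strong type. -/
theorem not_isStrongType_of_not_onTest {p₁ p₂ r : ℝ≥0∞}
    (h : ¬ IsStrongTypeOnTest p₁ p₂ r) : ¬ IsStrongType p₁ p₂ r :=
  fun h' => h h'.onTest

end CircularBilinear

end

namespace CircularBilinear

/-! Pair `T(f₁, f₂)` with a third function to get the trilinear form `∫∫ F(x - cos t) G(x - sin t)
H(x) dt dx`. Translating `x` for fixed `t` recentres it at any one of the three functions. The
pairwise differences of the arguments are, up to sign, `cos t`, `sin t` and `sin t - cos t`, all of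
the shape `l cos(t + θ)` with `l ≥ 1`. The substitution `u = l cos(t + θ)` degenerates only at two
nondegenerate critical points, where the Jacobian vanishes to first order. The geometric fact behind
the bounds is `jacobian_cases`: at each `t` at most one of the three Jacobians is small.

One phase alone sends a set `E` to a set of angles of measure `O(|E|^{1/2})` (`circ_phase_mem_le`).
Together with the layer-cake formula this gives the endpoints P and E, and testing on superlevel
sets gives the weak bound at K. At B and G this square-root bound is combined with the linear bound
of a nondegenerate phase (`circ_sub_cos_mem_sub_sin_mem_le`, `setLIntegral_mem_mul_le`). At M the
form is split according to which phase may degenerate. That pair of functions is controlled by a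
Hardy–Littlewood–Sobolev inequality (`lintegral_phase_pair_le`), the third function by two
nondegenerate changes of variable, and Hölder interpolates (`lintegral_trilinear_le`). Since O and C
have no singularity to resolve, they need only the finite length of the circle.

For the failures, let one argument be stationary at `t₀` and another Lipschitz there. Powers
`|u|^{-b}` and `|u|^{-a}` of these arguments with `a + 2b = 1` multiply to `|t - t₀|^{-1}`
(`le_lintegral_peak_mul_peak`). Truncated at scale `e^{-n}`, the integral grows like `n`, whereas
the product of the norms grows like `n^{a+b} = n^{1-b}`. When `r = ∞` the two factors are `f₁, f₂`;
when `p₂ = 1` the function `f₂` is an approximate delta and the factors are `f₁` and a dual function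
`H`. -/

/-- Lebesgue measure on the period `(0, 2π]`. -/
noncomputable abbrev circ : Measure ℝ := volume.restrict (Set.Ioc 0 (2 * Real.pi))

/-! ### Changes of variable on the circle -/

theorem lintegral_circ_add {f : ℝ → ℝ≥0∞} (hf : Function.Periodic f (2 * Real.pi)) (θ : ℝ) :
    ∫⁻ t, f (t + θ) ∂circ = ∫⁻ t, f t ∂circ := by
  have h2 : (0 : ℝ) < 2 * Real.pi := Real.two_pi_pos
  have e : ∫⁻ t, f (t + θ) ∂circ
      = ∫⁻ t in Set.Ioc θ (θ + 2 * Real.pi), f t := by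
    have hm : MeasurePreserving (fun t : ℝ => t + θ) volume volume :=
      measurePreserving_add_right volume θ
    have := hm.setLIntegral_comp_preimage_emb (measurableEmbedding_addRight θ) f
      (Set.Ioc θ (θ + 2 * Real.pi))
    rw [← this]
    congr 2
    ext t
    simp [add_comm]
  rw [e]
  have h0 := isAddFundamentalDomain_Ioc h2 0 volume
  have h1 := isAddFundamentalDomain_Ioc h2 θ volume
  rw [zero_add] at h0
  refine h1.setLIntegral_eq h0 f ?_
  rintro ⟨g, hg⟩ x
  obtain ⟨k, rfl⟩ := AddSubgroup.mem_zmultiples_iff.1 hg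
  have := hf.zsmul k x
  simpa [AddSubgroup.vadd_def, add_comm] using this

theorem lintegral_circ_split (f : ℝ → ℝ≥0∞) (hf : Function.Periodic f (2 * Real.pi)) :
    ∫⁻ t, f t ∂circ = (∫⁻ t in Set.Ioc 0 Real.pi, f t) + ∫⁻ t in Set.Ioc 0 Real.pi, f (-t) := by
  have hpi := Real.pi_pos
  have : Set.Ioc 0 (2 * Real.pi) = Set.Ioc 0 Real.pi ∪ Set.Ioc Real.pi (2 * Real.pi) :=
    (Set.Ioc_union_Ioc_eq_Ioc hpi.le (by linarith)).symm
  rw [circ, this, lintegral_union measurableSet_Ioc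
    (Set.disjoint_left.2 fun t h1 h2 => absurd h1.2 (not_le.2 h2.1))]
  congr 1
  have hm : MeasurePreserving (fun t : ℝ => 2 * Real.pi - t) volume volume :=
    Measure.measurePreserving_sub_left volume _
  have e := hm.setLIntegral_comp_preimage_emb
    (MeasurableEquiv.subLeft (2 * Real.pi)).measurableEmbedding f
    (Set.Ioc Real.pi (2 * Real.pi))
  rw [← e]
  have h2 : (fun t : ℝ => 2 * Real.pi - t) ⁻¹' Set.Ioc Real.pi (2 * Real.pi) = Set.Ico 0 Real.pi := by
    ext t; simp only [Set.mem_preimage, Set.mem_Ioc, Set.mem_Ico]; constructor <;> rintro ⟨a, b⟩ <;>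
      constructor <;> linarith
  rw [h2, setLIntegral_congr Ico_ae_eq_Ioc]
  refine lintegral_congr fun t => ?_
  rw [show 2 * Real.pi - t = -t + 2 * Real.pi by ring, hf]

/-- Cosine is injective on each half-period, so the area formula costs one copy of `∫ G` per half.
-/
theorem lintegral_cos_mul_abs_sin_le (G : ℝ → ℝ≥0∞) :
    ∫⁻ t, G (Real.cos t) * ENNReal.ofReal |Real.sin t| ∂circ ≤ 2 * ∫⁻ u, G u := by
  have key : ∫⁻ t in Set.Ioc 0 Real.pi, G (Real.cos t) * ENNReal.ofReal |Real.sin t|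
      ≤ ∫⁻ u, G u := by
    have := lintegral_image_eq_lintegral_abs_deriv_mul (s := Set.Ioc 0 Real.pi)
      (f := Real.cos) (f' := fun t => - Real.sin t) measurableSet_Ioc
      (fun t _ => (Real.hasDerivAt_cos t).hasDerivWithinAt)
      (Real.injOn_cos.mono Set.Ioc_subset_Icc_self) G
    calc _ = ∫⁻ u in Real.cos '' Set.Ioc 0 Real.pi, G u := by
          rw [this]; simp only [abs_neg, mul_comm]
      _ ≤ _ := setLIntegral_le_lintegral _ _
  rw [lintegral_circ_split _ (fun t => by simp), two_mul]
  refine add_le_add key ?_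
  simpa using key

theorem lintegral_phase_mul_abs_sin_le (G : ℝ → ℝ≥0∞) {l : ℝ} (hl : 1 ≤ l) (θ y : ℝ) :
    ∫⁻ t, G (y + l * Real.cos (t + θ)) * ENNReal.ofReal |Real.sin (t + θ)| ∂circ
      ≤ 2 * ∫⁻ u, G u := by
  rw [lintegral_circ_add (f := fun t => G (y + l * Real.cos t) * ENNReal.ofReal |Real.sin t|)
    (fun t => by simp)]
  refine (lintegral_cos_mul_abs_sin_le fun u => G (y + l * u)).trans ?_
  refine mul_le_mul' le_rfl ?_
  have h0 : l ≠ 0 := by positivity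
  have := lintegral_image_eq_lintegral_abs_deriv_mul (s := Set.univ)
      (f := fun u => y + l * u) (f' := fun t => l) MeasurableSet.univ
      (fun t _ => by
        have h := ((hasDerivAt_id t).const_mul l).const_add y
        rw [mul_one] at h
        exact h.hasDerivWithinAt)
      (fun a _ b _ h => by simpa [h0] using h) G
  calc _ ≤ ∫⁻ u, ENNReal.ofReal |l| * G (y + l * u) := by
        -- Scaling by `l ≥ 1` only improves the bound, so one constant serves both `l = 1` and `l =
        -- √2`.
        refine lintegral_mono fun u => le_mul_of_one_le_left (zero_le) ?_
        rw [abs_of_nonneg (by linarith)]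
        simpa using ENNReal.ofReal_le_ofReal hl
    _ ≤ ∫⁻ u, G u := by
      rw [Measure.restrict_univ] at this
      rw [← this]; exact setLIntegral_le_lintegral _ _

/-- On each of the four quarter-periods `|sin|` is at least half the distance to its zero, so
monotonicity of `w` costs a factor 2 per quarter. -/
theorem lintegral_antitone_abs_sin_le {w : ℝ → ℝ≥0∞} (hw : Antitone w) (θ : ℝ) :
    ∫⁻ t, w |Real.sin (t + θ)| ∂circ ≤ 8 * ∫⁻ u in Set.Ioi 0, w u := by
  have hpi := Real.pi_pos
  have key : ∫⁻ t in Set.Ioc 0 (Real.pi / 2), w |Real.sin t| ≤ 2 * ∫⁻ u in Set.Ioi 0, w u := by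
    calc _ ≤ ∫⁻ t in Set.Ioc 0 (Real.pi / 2), w (2⁻¹ * t) := by
          refine setLIntegral_mono' measurableSet_Ioc fun t ht => hw ?_
          have h1 := Real.mul_le_sin ht.1.le ht.2
          have h2 : 2⁻¹ * t ≤ 2 / Real.pi * t := by
            refine mul_le_mul_of_nonneg_right ?_ ht.1.le
            rw [inv_eq_one_div, div_le_div_iff₀ (by norm_num) hpi]
            linarith [Real.pi_le_four]
          exact h2.trans (h1.trans (le_abs_self _))
      _ ≤ ∫⁻ t in Set.Ioi 0, w (2⁻¹ * t) :=
          lintegral_mono_set fun t ht => ht.1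
      _ = 2 * ∫⁻ u in Set.Ioi 0, w u := by
          have := lintegral_image_eq_lintegral_abs_deriv_mul (s := Set.Ioi 0)
            (f := fun u : ℝ => 2⁻¹ * u) (f' := fun t => 2⁻¹) measurableSet_Ioi
            (fun t _ => by simpa using ((hasDerivAt_id t).const_mul (2⁻¹ : ℝ)).hasDerivWithinAt)
            (fun a _ b _ h => by simpa using h) w
          have h3 : (fun u : ℝ => 2⁻¹ * u) '' Set.Ioi 0 = Set.Ioi 0 := by
            rw [Set.image_mul_left_Ioi (by norm_num)]; simp
          rw [h3] at this
          rw [this, lintegral_const_mul' _ _ (by simp), ← mul_assoc]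
          have : (2 : ℝ≥0∞) * ENNReal.ofReal |2⁻¹| = 1 := by
            rw [abs_of_pos (by norm_num), ENNReal.ofReal_inv_of_pos (by norm_num)]
            simp [ENNReal.mul_inv_cancel]
          rw [this, one_mul]
  have half : ∫⁻ t in Set.Ioc 0 Real.pi, w |Real.sin t| ≤ 4 * ∫⁻ u in Set.Ioi 0, w u := by
    have : Set.Ioc 0 Real.pi = Set.Ioc 0 (Real.pi / 2) ∪ Set.Ioc (Real.pi / 2) Real.pi :=
      (Set.Ioc_union_Ioc_eq_Ioc (by linarith) (by linarith)).symm
    rw [this, lintegral_union measurableSet_Ioc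
      (Set.disjoint_left.2 fun t h1 h2 => absurd h1.2 (not_le.2 h2.1)),
      show (4 : ℝ≥0∞) = 2 + 2 by norm_num, add_mul]
    refine add_le_add key ?_
    have hm : MeasurePreserving (fun t : ℝ => Real.pi - t) volume volume :=
      Measure.measurePreserving_sub_left volume _
    have e := hm.setLIntegral_comp_preimage_emb
      (MeasurableEquiv.subLeft Real.pi).measurableEmbedding (fun t => w |Real.sin t|)
      (Set.Ioc (Real.pi / 2) Real.pi)
    have h2 : (fun t : ℝ => Real.pi - t) ⁻¹' Set.Ioc (Real.pi / 2) Real.pi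
        = Set.Ico 0 (Real.pi / 2) := by
      ext t; simp only [Set.mem_preimage, Set.mem_Ioc, Set.mem_Ico]
      constructor <;> rintro ⟨a, b⟩ <;> constructor <;> linarith
    rw [← e, h2, setLIntegral_congr Ico_ae_eq_Ioc]
    simpa using key
  rw [lintegral_circ_add (f := fun t => w |Real.sin t|) (fun t => by simp),
    lintegral_circ_split _ (fun t => by simp), show (8 : ℝ≥0∞) = 4 + 4 by norm_num, add_mul]
  refine add_le_add half ?_
  simpa using half

/-! ### Powers of the Jacobian -/

theorem circ_univ_lt_top : circ Set.univ < ∞ :=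
  measure_lt_top _ _

theorem ofReal_rpow_antitone {r : ℝ} (hr : 0 ≤ r) :
    Antitone fun u : ℝ => ENNReal.ofReal u ^ (-r) := fun a b hab => by
  simp only [ENNReal.rpow_neg]
  exact ENNReal.inv_le_inv.2 (ENNReal.rpow_le_rpow (ENNReal.ofReal_le_ofReal hab) hr)

theorem lintegral_Ioc_rpow_neg_half {ρ : ℝ} (hρ : 0 < ρ) :
    ∫⁻ u in Set.Ioc 0 ρ, ENNReal.ofReal u ^ (-(1 / 2 : ℝ)) = 2 * ENNReal.ofReal ρ ^ (1 / 2 : ℝ) := by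
  have h1 : ∫⁻ u in Set.Ioc 0 ρ, ENNReal.ofReal u ^ (-(1 / 2 : ℝ))
      = ∫⁻ u in Set.Ioc 0 ρ, ENNReal.ofReal (u ^ (-(1 / 2 : ℝ))) :=
    setLIntegral_congr_fun measurableSet_Ioc fun u hu => ENNReal.ofReal_rpow_of_pos hu.1
  have hi : IntervalIntegrable (fun u : ℝ => u ^ (-(1 / 2 : ℝ))) volume 0 ρ :=
    intervalIntegral.intervalIntegrable_rpow' (by norm_num)
  rw [h1, ← ofReal_integral_eq_lintegral_ofReal
    ((intervalIntegrable_iff_integrableOn_Ioc_of_le hρ.le).1 hi)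
    ((ae_restrict_iff' measurableSet_Ioc).2 (.of_forall fun u hu => Real.rpow_nonneg hu.1.le _)),
    ← intervalIntegral.integral_of_le hρ.le, integral_rpow (Or.inl (by norm_num)),
    ENNReal.ofReal_rpow_of_pos hρ, ← ENNReal.ofReal_ofNat 2, ← ENNReal.ofReal_mul (by norm_num)]
  congr 1
  rw [show (-(1 / 2 : ℝ) + 1) = 1 / 2 by norm_num, Real.zero_rpow (by norm_num)]
  ring

theorem lintegral_Ioi_rpow_neg_three {ρ : ℝ} (hρ : 0 < ρ) :
    ∫⁻ u in Set.Ioi ρ, ENNReal.ofReal u ^ (-3 : ℝ) ≤ ENNReal.ofReal ρ ^ (-2 : ℝ) := by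
  have h1 : ∫⁻ u in Set.Ioi ρ, ENNReal.ofReal u ^ (-3 : ℝ)
      = ∫⁻ u in Set.Ioi ρ, ENNReal.ofReal (u ^ (-3 : ℝ)) :=
    setLIntegral_congr_fun measurableSet_Ioi fun u hu =>
      ENNReal.ofReal_rpow_of_pos (hρ.trans hu)
  rw [h1, ← ofReal_integral_eq_lintegral_ofReal
    (integrableOn_Ioi_rpow_of_lt (by norm_num) hρ)
    ((ae_restrict_iff' measurableSet_Ioi).2
      (.of_forall fun u hu => Real.rpow_nonneg (hρ.trans hu).le _)),
    integral_Ioi_rpow_of_lt (by norm_num) hρ, ENNReal.ofReal_rpow_of_pos hρ]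
  refine ENNReal.ofReal_le_ofReal ?_
  rw [show (-3 + 1 : ℝ) = -2 by norm_num]
  have := Real.rpow_nonneg hρ.le (-2)
  linarith

theorem circ_abs_sin_le (ρ : ℝ) (θ : ℝ) :
    circ {t | |Real.sin (t + θ)| ≤ ρ} ≤ 8 * ENNReal.ofReal ρ := by
  have hw : Antitone ((Set.Iic ρ).indicator fun _ => (1 : ℝ≥0∞)) := by
    intro a b hab
    by_cases hb : b ≤ ρ
    · simp [Set.indicator, hb, hab.trans hb]
    · simp [Set.indicator, hb]
  have := lintegral_antitone_abs_sin_le hw θ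
  have hm : MeasurableSet {t | |Real.sin (t + θ)| ≤ ρ} :=
    measurableSet_le (by fun_prop) measurable_const
  calc _ = ∫⁻ t, (Set.Iic ρ).indicator (fun _ => (1 : ℝ≥0∞)) |Real.sin (t + θ)| ∂circ := by
        rw [← lintegral_indicator_one hm]; rfl
    _ ≤ _ := this
    _ = _ := by
        rw [lintegral_indicator measurableSet_Iic, setLIntegral_one,
          Measure.restrict_apply measurableSet_Iic, Set.inter_comm, Set.Ioi_inter_Iic]
        simp

theorem ae_circ_sin_ne_zero (θ : ℝ) : ∀ᵐ t ∂circ, Real.sin (t + θ) ≠ 0 := by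
  have h := circ_abs_sin_le 0 θ
  rw [ENNReal.ofReal_zero, mul_zero, nonpos_iff_eq_zero] at h
  rw [ae_iff]
  refine measure_mono_null (fun t ht => ?_) h
  simpa using ht

/-- `|sin|^{-1/2}` lies in weak `L²` of the circle. Cutting at `|sin| = ρ` with `ρ = |S|` balances
the bounded part `ρ^{-1/2}|S|` against the singular part, which is of order `ρ^{1/2}`. -/
theorem setLIntegral_abs_sin_rpow_neg_half_le (S : Set ℝ) (θ : ℝ) :
    ∫⁻ t in S, ENNReal.ofReal |Real.sin (t + θ)| ^ (-(1 / 2 : ℝ)) ∂circ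
      ≤ 17 * circ S ^ (1 / 2 : ℝ) := by
  rcases eq_or_ne (circ S) 0 with h0 | h0
  · rw [setLIntegral_measure_zero _ _ h0]; exact zero_le
  have ht : circ S ≠ ∞ := ((measure_mono (Set.subset_univ S)).trans_lt circ_univ_lt_top).ne
  obtain ⟨ρ, hρ, he⟩ : ∃ ρ : ℝ, 0 < ρ ∧ circ S = ENNReal.ofReal ρ :=
    ⟨_, ENNReal.toReal_pos h0 ht, (ENNReal.ofReal_toReal ht).symm⟩
  set w : ℝ → ℝ≥0∞ := (Set.Iic ρ).indicator fun u => ENNReal.ofReal u ^ (-(1 / 2 : ℝ)) with hwdef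
  have hw : Antitone w := by
    intro a b hab
    by_cases hb : b ≤ ρ
    · simpa [hwdef, Set.indicator, hb, hab.trans hb] using
        ofReal_rpow_antitone (r := 1 / 2) (by norm_num) hab
    · simp [hwdef, Set.indicator, hb]
  have hpt : ∀ t : ℝ, ENNReal.ofReal |Real.sin (t + θ)| ^ (-(1 / 2 : ℝ))
      ≤ ENNReal.ofReal ρ ^ (-(1 / 2 : ℝ)) + w |Real.sin (t + θ)| := by
    intro t
    by_cases hb : |Real.sin (t + θ)| ≤ ρ
    · simp only [hwdef, Set.indicator, Set.mem_Iic, hb, if_true]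
      exact le_add_self
    · exact (ofReal_rpow_antitone (r := 1 / 2) (by norm_num) (not_le.1 hb).le).trans le_self_add
  have hρ0 : ENNReal.ofReal ρ ≠ 0 := by simpa using hρ
  calc _ ≤ ∫⁻ t in S, (ENNReal.ofReal ρ ^ (-(1 / 2 : ℝ)) + w |Real.sin (t + θ)|) ∂circ :=
        lintegral_mono hpt
    _ = ENNReal.ofReal ρ ^ (-(1 / 2 : ℝ)) * circ S + ∫⁻ t in S, w |Real.sin (t + θ)| ∂circ := by
        rw [lintegral_add_left measurable_const, setLIntegral_const]
    _ ≤ ENNReal.ofReal ρ ^ (1 / 2 : ℝ) + 16 * ENNReal.ofReal ρ ^ (1 / 2 : ℝ) := by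
        refine add_le_add ?_ ?_
        · rw [he]
          nth_rw 2 [← ENNReal.rpow_one (ENNReal.ofReal ρ)]
          rw [← ENNReal.rpow_add _ _ hρ0 ENNReal.ofReal_ne_top]
          norm_num
        · refine (setLIntegral_le_lintegral _ _).trans
            ((lintegral_antitone_abs_sin_le hw θ).trans ?_)
          rw [hwdef, lintegral_indicator measurableSet_Iic,
            Measure.restrict_restrict measurableSet_Iic, Set.inter_comm, Set.Ioi_inter_Iic,
            lintegral_Ioc_rpow_neg_half hρ, ← mul_assoc]
          norm_num
    _ = 17 * circ S ^ (1 / 2 : ℝ) := by rw [he]; ring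

theorem setLIntegral_abs_sin_rpow_neg_three_le {ρ : ℝ} (hρ : 0 < ρ) (θ : ℝ) :
    ∫⁻ t in {t | ρ < |Real.sin (t + θ)|}, ENNReal.ofReal |Real.sin (t + θ)| ^ (-3 : ℝ) ∂circ
      ≤ 16 * ENNReal.ofReal ρ ^ (-2 : ℝ) := by
  -- Freezing the power below `ρ` keeps it antitone and integrable; the frozen piece contributes `ρ
  -- · ρ^{-3}`, the same size as the tail.
  set w : ℝ → ℝ≥0∞ := fun u => ENNReal.ofReal (max u ρ) ^ (-3 : ℝ) with hwdef
  have hw : Antitone w := fun a b hab =>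
    ofReal_rpow_antitone (r := 3) (by norm_num) (max_le_max_right ρ hab)
  have hm : MeasurableSet {t | ρ < |Real.sin (t + θ)|} :=
    measurableSet_lt measurable_const (by fun_prop)
  have hρ0 : ENNReal.ofReal ρ ≠ 0 := by simpa using hρ
  calc _ = ∫⁻ t in {t | ρ < |Real.sin (t + θ)|}, w |Real.sin (t + θ)| ∂circ :=
        setLIntegral_congr_fun hm fun t ht => by
          simp only [hwdef]; rw [max_eq_left (le_of_lt ht)]
    _ ≤ _ := setLIntegral_le_lintegral _ _
    _ ≤ _ := lintegral_antitone_abs_sin_le hw θ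
    _ ≤ 8 * (ENNReal.ofReal ρ ^ (-2 : ℝ) + ENNReal.ofReal ρ ^ (-2 : ℝ)) := by
        refine mul_le_mul' le_rfl ?_
        rw [← Set.Ioc_union_Ioi_eq_Ioi hρ.le, lintegral_union measurableSet_Ioi
          (Set.disjoint_left.2 fun t h1 h2 => absurd h1.2 (not_le.2 h2))]
        refine add_le_add ?_ ?_
        · rw [setLIntegral_congr_fun (g := fun _ => ENNReal.ofReal ρ ^ (-3 : ℝ)) measurableSet_Ioc
            (fun t ht => by simp only [hwdef]; rw [max_eq_right ht.2]), setLIntegral_const,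
            Real.volume_Ioc, sub_zero]
          nth_rw 2 [← ENNReal.rpow_one (ENNReal.ofReal ρ)]
          rw [← ENNReal.rpow_add _ _ hρ0 ENNReal.ofReal_ne_top]
          norm_num
        · rw [setLIntegral_congr_fun (g := fun u => ENNReal.ofReal u ^ (-3 : ℝ)) measurableSet_Ioi
            (fun t ht => by simp only [hwdef]; rw [max_eq_left (le_of_lt ht)])]
          exact lintegral_Ioi_rpow_neg_three hρ
    _ = _ := by ring

/-! ### Estimates for a single phase -/

/-- The phase functions `λ cos (t + θ)` that occur in the trilinear form of `T`. -/
noncomputable def phase (l θ t : ℝ) : ℝ := l * Real.cos (t + θ)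

@[fun_prop]
theorem measurable_phase (l θ : ℝ) : Measurable (phase l θ) := by
  unfold phase; fun_prop

theorem lintegral_phase_mul_le (G : ℝ → ℝ≥0∞) {l : ℝ} (hl : 1 ≤ l) (θ y : ℝ) :
    ∫⁻ t, G (y + phase l θ t) * ENNReal.ofReal |Real.sin (t + θ)| ∂circ ≤ 2 * ∫⁻ u, G u :=
  lintegral_phase_mul_abs_sin_le G hl θ y

theorem rpow_le_self_of_one_le {c : ℝ≥0∞} (hc : 1 ≤ c) {r : ℝ} (hr : r ≤ 1) : c ^ r ≤ c := by
  simpa using ENNReal.rpow_le_rpow_of_exponent_le hc hr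

/-- Hölder with exponents 3 and 3/2 after writing `h = (h³|sin|)^{1/3} (|sin|^{-1/2})^{2/3}`: the
first factor absorbs the Jacobian, the second is integrated over `S`. -/
theorem setLIntegral_phase_le {h : ℝ → ℝ≥0∞} (hh : Measurable h) (S : Set ℝ)
    {l : ℝ} (hl : 1 ≤ l) (θ y : ℝ) :
    ∫⁻ t in S, h (y + phase l θ t) ∂circ
      ≤ 34 * (∫⁻ u, h u ^ (3 : ℝ)) ^ (1 / 3 : ℝ) * circ S ^ (1 / 3 : ℝ) := by
  have hae : ∀ᵐ t ∂(circ.restrict S), Real.sin (t + θ) ≠ 0 :=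
    ae_restrict_of_ae (ae_circ_sin_ne_zero θ)
  calc _ = ∫⁻ t in S, (h (y + phase l θ t) ^ (3 : ℝ) * ENNReal.ofReal |Real.sin (t + θ)|)
          ^ (1 / 3 : ℝ) * (ENNReal.ofReal |Real.sin (t + θ)| ^ (-(1 / 2 : ℝ))) ^ (2 / 3 : ℝ)
          ∂circ := by
        refine lintegral_congr_ae ?_
        filter_upwards [hae] with t ht
        have h0 : ENNReal.ofReal |Real.sin (t + θ)| ≠ 0 := by simpa using ht
        rw [ENNReal.mul_rpow_of_nonneg _ _ (by norm_num), ← ENNReal.rpow_mul, ← ENNReal.rpow_mul,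
          mul_assoc, ← ENNReal.rpow_add _ _ h0 ENNReal.ofReal_ne_top]
        norm_num
    _ ≤ (∫⁻ t in S, h (y + phase l θ t) ^ (3 : ℝ) * ENNReal.ofReal |Real.sin (t + θ)| ∂circ)
          ^ (1 / 3 : ℝ) * (∫⁻ t in S, ENNReal.ofReal |Real.sin (t + θ)| ^ (-(1 / 2 : ℝ)) ∂circ)
          ^ (2 / 3 : ℝ) :=
        ENNReal.lintegral_mul_norm_pow_le (by fun_prop) (by fun_prop) (by norm_num) (by norm_num)
          (by norm_num)
    _ ≤ (2 * ∫⁻ u, h u ^ (3 : ℝ)) ^ (1 / 3 : ℝ) * (17 * circ S ^ (1 / 2 : ℝ)) ^ (2 / 3 : ℝ) := by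
        gcongr
        · exact (setLIntegral_le_lintegral _ _).trans
            (lintegral_phase_mul_le (fun u => h u ^ (3 : ℝ)) hl θ y)
        · exact setLIntegral_abs_sin_rpow_neg_half_le S θ
    _ = (2 ^ (1 / 3 : ℝ) * 17 ^ (2 / 3 : ℝ)) * (∫⁻ u, h u ^ (3 : ℝ)) ^ (1 / 3 : ℝ)
          * circ S ^ (1 / 3 : ℝ) := by
        rw [ENNReal.mul_rpow_of_nonneg _ _ (by norm_num), ENNReal.mul_rpow_of_nonneg _ _ (by norm_num),
          ← ENNReal.rpow_mul, show (1 / 2 * (2 / 3) : ℝ) = 1 / 3 by norm_num]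
        ring
    _ ≤ (2 * 17) * (∫⁻ u, h u ^ (3 : ℝ)) ^ (1 / 3 : ℝ) * circ S ^ (1 / 3 : ℝ) := by
        gcongr <;> exact rpow_le_self_of_one_le (by norm_num) (by norm_num)
    _ = _ := by norm_num

/-- A bootstrap: taking `h` to be the indicator of `E` and `S` its preimage in the `L³` bound gives
`|S| ≤ 34 |E|^{1/3} |S|^{1/3}`, and `|S|`, being finite, can be divided out. The square root is the
loss at a nondegenerate critical point. -/
theorem circ_phase_mem_le {E : Set ℝ} (hE : MeasurableSet E) {l : ℝ} (hl : 1 ≤ l) (θ y : ℝ) :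
    circ {t | y + phase l θ t ∈ E} ≤ 1156 * volume E ^ (1 / 2 : ℝ) := by
  set S := {t | y + phase l θ t ∈ E} with hSdef
  have hS : MeasurableSet S := (by fun_prop : Measurable fun t => y + phase l θ t) hE
  have ht : circ S ≠ ∞ := ((measure_mono (Set.subset_univ S)).trans_lt circ_univ_lt_top).ne
  rcases eq_or_ne (circ S) 0 with h0 | h0
  · rw [h0]; exact zero_le
  have key : circ S ≤ 34 * volume E ^ (1 / 3 : ℝ) * circ S ^ (1 / 3 : ℝ) := by
    have := setLIntegral_phase_le (h := E.indicator 1) (measurable_one.indicator hE) S hl θ y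
    have e1 : ∫⁻ t in S, E.indicator 1 (y + phase l θ t) ∂circ = circ S := by
      rw [setLIntegral_congr_fun (g := fun _ => 1) hS
        (fun t ht => by simp [Set.indicator_of_mem (show y + phase l θ t ∈ E from ht)])]
      simp
    have e2 : ∫⁻ u, (E.indicator 1 u : ℝ≥0∞) ^ (3 : ℝ) = volume E := by
      rw [← lintegral_indicator_one hE]
      refine lintegral_congr fun u => ?_
      by_cases hu : u ∈ E <;> simp [hu]
    rwa [e1, e2] at this
  have k2 : circ S ^ (2 / 3 : ℝ) ≤ 34 * volume E ^ (1 / 3 : ℝ) := by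
    have hp : circ S ^ (1 / 3 : ℝ) ≠ 0 := fun hz => by
      rcases ENNReal.rpow_eq_zero_iff.1 hz with h | h
      · exact h0 h.1
      · exact ht h.1
    have hp' : circ S ^ (1 / 3 : ℝ) ≠ ∞ := ENNReal.rpow_ne_top_of_nonneg (by norm_num) ht
    refine (ENNReal.mul_le_mul_iff_left hp hp').1 ?_
    rw [← ENNReal.rpow_add _ _ h0 ht]
    norm_num at key ⊢
    exact key
  calc circ S = (circ S ^ (2 / 3 : ℝ)) ^ (3 / 2 : ℝ) := by rw [← ENNReal.rpow_mul]; norm_num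
    _ ≤ (34 * volume E ^ (1 / 3 : ℝ)) ^ (3 / 2 : ℝ) := by gcongr
    _ = 34 ^ (3 / 2 : ℝ) * volume E ^ (1 / 2 : ℝ) := by
        rw [ENNReal.mul_rpow_of_nonneg _ _ (by norm_num), ← ENNReal.rpow_mul]; norm_num
    _ ≤ 34 ^ (2 : ℝ) * volume E ^ (1 / 2 : ℝ) := by
        gcongr
        · norm_num
        · norm_num
    _ = _ := by norm_num

theorem setLIntegral_phase_le_of_le_abs_sin (G : ℝ → ℝ≥0∞) {l : ℝ} (hl : 1 ≤ l) (θ y : ℝ)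
    {S : Set ℝ} (hS : MeasurableSet S) (h : ∀ t ∈ S, 1 / 8 ≤ |Real.sin (t + θ)|) :
    ∫⁻ t in S, G (y + phase l θ t) ∂circ ≤ 16 * ∫⁻ u, G u := by
  calc _ ≤ ∫⁻ t in S, 8 * (G (y + phase l θ t) * ENNReal.ofReal |Real.sin (t + θ)|) ∂circ := by
        refine setLIntegral_mono' hS fun t ht => ?_
        have h1 : 1 ≤ 8 * ENNReal.ofReal |Real.sin (t + θ)| := by
          rw [← ENNReal.ofReal_ofNat 8, ← ENNReal.ofReal_mul (by norm_num), ENNReal.one_le_ofReal]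
          linarith [h t ht]
        calc _ = G (y + phase l θ t) * 1 := (mul_one _).symm
          _ ≤ G (y + phase l θ t) * (8 * ENNReal.ofReal |Real.sin (t + θ)|) := by gcongr
          _ = _ := by ring
    _ ≤ _ := setLIntegral_le_lintegral _ _
    _ = 8 * ∫⁻ t, (G (y + phase l θ t) * ENNReal.ofReal |Real.sin (t + θ)|) ∂circ :=
        lintegral_const_mul' _ _ (by simp)
    _ ≤ 8 * (2 * ∫⁻ u, G u) := mul_le_mul' le_rfl (lintegral_phase_mul_le G hl θ y)
    _ = _ := by rw [← mul_assoc]; norm_num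

/-! ### Hardy–Littlewood–Sobolev for one phase -/

/-- Translation invariance in `x` for each fixed `t`; this recentres a multilinear form at any of
its functions. -/
theorem lintegral_lintegral_shift {ν : Measure ℝ} [SFinite ν] {K : ℝ → ℝ → ℝ≥0∞}
    (hK : Measurable (Function.uncurry K)) {γ : ℝ → ℝ} (hγ : Measurable γ) :
    ∫⁻ x, ∫⁻ t, K x t ∂ν = ∫⁻ y, ∫⁻ t, K (y + γ t) t ∂ν := by
  have hm : Measurable fun z : ℝ × ℝ => (z.1 + γ z.2, z.2) := by fun_prop
  rw [lintegral_lintegral_swap hK.aemeasurable,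
    lintegral_lintegral_swap (f := fun y t => K (y + γ t) t) (hK.comp hm).aemeasurable]
  exact lintegral_congr fun t => (lintegral_add_right_eq_self (fun x => K x t) (γ t)).symm

theorem setLIntegral_phase_le_rpow {F : ℝ → ℝ≥0∞} (hF : Measurable F)
    (hF1 : ∫⁻ u, F u ^ (4 / 3 : ℝ) ≤ 1) {l : ℝ} (hl : 1 ≤ l) (θ y : ℝ) {a : ℝ≥0∞}
    (ha0 : a ≠ 0) (hat : a ≠ ∞) :
    ∫⁻ t in {t | F (y + phase l θ t) ≤ a}, F (y + phase l θ t) ∂circ ≤ 40 * a ^ (1 / 3 : ℝ) := by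
  have hg : Measurable fun t => F (y + phase l θ t) := by fun_prop
  have hS : MeasurableSet {t | F (y + phase l θ t) ≤ a} := measurableSet_le hg measurable_const
  have hα : 0 < a.toReal := ENNReal.toReal_pos ha0 hat
  -- This `ρ` equalises the two bounds: `F ≤ a` gives `aρ` near the critical points, Hölder with
  -- `|sin|^{-3}` gives `ρ^{-1/2}` away from them, and both become `a^{1/3}`.
  set ρ : ℝ := a.toReal ^ (-(2 / 3) : ℝ) with hρdef
  have hρ : 0 < ρ := Real.rpow_pos_of_pos hα _
  have hρe : ENNReal.ofReal ρ = a ^ (-(2 / 3) : ℝ) := by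
    rw [hρdef, ← ENNReal.ofReal_rpow_of_pos hα, ENNReal.ofReal_toReal hat]
  have hm : MeasurableSet {t | ρ < |Real.sin (t + θ)|} :=
    measurableSet_lt measurable_const (by fun_prop)
  have small : ∫⁻ t in {t | F (y + phase l θ t) ≤ a} ∩ {t | |Real.sin (t + θ)| ≤ ρ},
      F (y + phase l θ t) ∂circ ≤ 8 * a ^ (1 / 3 : ℝ) := by
    have hm' : MeasurableSet {t | |Real.sin (t + θ)| ≤ ρ} :=
      measurableSet_le (by fun_prop) measurable_const
    calc _ ≤ ∫⁻ t in {t | F (y + phase l θ t) ≤ a} ∩ {t | |Real.sin (t + θ)| ≤ ρ}, a ∂circ :=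
          setLIntegral_mono' (hS.inter hm') fun t ht => ht.1
      _ ≤ a * circ {t | |Real.sin (t + θ)| ≤ ρ} := by
          rw [setLIntegral_const]
          exact mul_le_mul' le_rfl (measure_mono Set.inter_subset_right)
      _ ≤ a * (8 * ENNReal.ofReal ρ) := mul_le_mul' le_rfl (circ_abs_sin_le _ _)
      _ = 8 * (a ^ (1 : ℝ) * a ^ (-(2 / 3) : ℝ)) := by rw [hρe, ENNReal.rpow_one]; ring
      _ = _ := by rw [← ENNReal.rpow_add _ _ ha0 hat]; norm_num
  have large : ∫⁻ t in {t | ρ < |Real.sin (t + θ)|}, F (y + phase l θ t) ∂circ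
      ≤ 32 * a ^ (1 / 3 : ℝ) := by
    calc _ = ∫⁻ t in {t | ρ < |Real.sin (t + θ)|},
          (F (y + phase l θ t) ^ (4 / 3 : ℝ) * ENNReal.ofReal |Real.sin (t + θ)|) ^ (3 / 4 : ℝ)
          * (ENNReal.ofReal |Real.sin (t + θ)| ^ (-3 : ℝ)) ^ (1 / 4 : ℝ) ∂circ := by
          refine setLIntegral_congr_fun hm fun t ht => ?_
          have h0 : ENNReal.ofReal |Real.sin (t + θ)| ≠ 0 := by
            simpa using (abs_pos.1 (hρ.trans ht))
          rw [ENNReal.mul_rpow_of_nonneg _ _ (by norm_num), ← ENNReal.rpow_mul,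
            ← ENNReal.rpow_mul, mul_assoc, ← ENNReal.rpow_add _ _ h0 ENNReal.ofReal_ne_top]
          norm_num
      _ ≤ (∫⁻ t in {t | ρ < |Real.sin (t + θ)|},
          F (y + phase l θ t) ^ (4 / 3 : ℝ) * ENNReal.ofReal |Real.sin (t + θ)| ∂circ)
            ^ (3 / 4 : ℝ) * (∫⁻ t in {t | ρ < |Real.sin (t + θ)|},
            ENNReal.ofReal |Real.sin (t + θ)| ^ (-3 : ℝ) ∂circ) ^ (1 / 4 : ℝ) :=
          ENNReal.lintegral_mul_norm_pow_le (by fun_prop) (by fun_prop) (by norm_num)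
            (by norm_num) (by norm_num)
      _ ≤ (2 * 1) ^ (3 / 4 : ℝ) * (16 * ENNReal.ofReal ρ ^ (-2 : ℝ)) ^ (1 / 4 : ℝ) := by
          gcongr
          · exact (setLIntegral_le_lintegral _ _).trans
              ((lintegral_phase_mul_le (fun u => F u ^ (4 / 3 : ℝ)) hl θ y).trans (by gcongr))
          · exact setLIntegral_abs_sin_rpow_neg_three_le hρ θ
      _ = 2 ^ (3 / 4 : ℝ) * 16 ^ (1 / 4 : ℝ) * a ^ (1 / 3 : ℝ) := by
          rw [ENNReal.mul_rpow_of_nonneg _ _ (by norm_num : (0 : ℝ) ≤ 1 / 4), hρe,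
            ← ENNReal.rpow_mul, ← ENNReal.rpow_mul, mul_one, mul_assoc]
          norm_num
      _ ≤ 2 * 16 * a ^ (1 / 3 : ℝ) := by
          gcongr <;> exact rpow_le_self_of_one_le (by norm_num) (by norm_num)
      _ = _ := by norm_num
  calc _ ≤ ∫⁻ t in ({t | F (y + phase l θ t) ≤ a} ∩ {t | |Real.sin (t + θ)| ≤ ρ}) ∪
        {t | ρ < |Real.sin (t + θ)|}, F (y + phase l θ t) ∂circ := by
        refine lintegral_mono_set fun t ht => ?_
        rcases le_or_gt |Real.sin (t + θ)| ρ with h | h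
        · exact Or.inl ⟨ht, h⟩
        · exact Or.inr h
    _ ≤ _ := lintegral_union_le _ _ _
    _ ≤ 8 * a ^ (1 / 3 : ℝ) + 32 * a ^ (1 / 3 : ℝ) := add_le_add small large
    _ = _ := by ring

/-- With the truncation level `a = G x`, the inner integral is at most `40 G(x)^{1/3}`, and the
remaining factor `G x` completes it to `G^{4/3}`. -/
theorem lintegral_phase_pair_le_half {F G : ℝ → ℝ≥0∞} (hF : Measurable F)
    (hF1 : ∫⁻ u, F u ^ (4 / 3 : ℝ) ≤ 1) (hG1 : ∫⁻ u, G u ^ (4 / 3 : ℝ) ≤ 1)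
    {l : ℝ} (hl : 1 ≤ l) (θ : ℝ) :
    ∫⁻ x, ∫⁻ t in {t | F (x + phase l θ t) ≤ G x}, F (x + phase l θ t) * G x ∂circ ≤ 40 := by
  calc _ ≤ ∫⁻ x, 40 * G x ^ (4 / 3 : ℝ) := by
        refine lintegral_mono fun x => ?_
        rcases eq_or_ne (G x) 0 with h0 | h0
        · simp [h0]
        rcases eq_or_ne (G x) ∞ with ht | ht
        · simp [ht]
        rw [lintegral_mul_const' _ _ ht]
        refine (mul_le_mul' (setLIntegral_phase_le_rpow hF hF1 hl θ x h0 ht) le_rfl).trans ?_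
        nth_rw 2 [← ENNReal.rpow_one (G x)]
        rw [mul_assoc, ← ENNReal.rpow_add _ _ h0 ht]
        norm_num
    _ = 40 * ∫⁻ x, G x ^ (4 / 3 : ℝ) := lintegral_const_mul' _ _ (by simp)
    _ ≤ 40 * 1 := by gcongr
    _ = 40 := by norm_num

theorem phase_add_pi (l θ t : ℝ) : phase l (θ + Real.pi) t = - phase l θ t := by
  simp [phase, ← add_assoc]

/-- The Hardy–Littlewood–Sobolev inequality at `L^{4/3} × L^{4/3}` for circular convolution. -/
theorem lintegral_phase_pair_le {F G : ℝ → ℝ≥0∞} (hF : Measurable F) (hG : Measurable G)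
    (hF1 : ∫⁻ u, F u ^ (4 / 3 : ℝ) ≤ 1) (hG1 : ∫⁻ u, G u ^ (4 / 3 : ℝ) ≤ 1)
    {l : ℝ} (hl : 1 ≤ l) (θ : ℝ) :
    ∫⁻ x, ∫⁻ t, F (x + phase l θ t) * G x ∂circ ≤ 80 := by
  have h1 := lintegral_phase_pair_le_half hF hF1 hG1 hl θ
  -- Adding `π` to `θ` reverses the sign of the phase, so after a shift in `x` the region where `G`
  -- is the smaller function is the same estimate with the roles exchanged.
  have h2 := lintegral_phase_pair_le_half hG hG1 hF1 hl (θ + Real.pi)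
  have e2 : ∫⁻ x, ∫⁻ t in {t | G x ≤ F (x + phase l θ t)}, F (x + phase l θ t) * G x ∂circ ≤ 40 := by
    set K : ℝ → ℝ → ℝ≥0∞ := fun x t =>
      {z : ℝ × ℝ | G z.1 ≤ F (z.1 + phase l θ z.2)}.indicator
        (fun z => F (z.1 + phase l θ z.2) * G z.1) (x, t) with hKdef
    have hK : Measurable (Function.uncurry K) :=
      (by fun_prop : Measurable fun z : ℝ × ℝ => F (z.1 + phase l θ z.2) * G z.1).indicator
        (measurableSet_le (by fun_prop) (by fun_prop))
    have e := lintegral_lintegral_shift (ν := circ) hK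
      (γ := phase l (θ + Real.pi)) (by fun_prop)
    have hm (x : ℝ) : MeasurableSet {t | G x ≤ F (x + phase l θ t)} :=
      measurableSet_le measurable_const (by fun_prop)
    have hm' (x : ℝ) : MeasurableSet {t | G (x + phase l (θ + Real.pi) t) ≤ F x} :=
      measurableSet_le (by fun_prop) measurable_const
    simp_rw [← lintegral_indicator (hm _)]
    simp_rw [← lintegral_indicator (hm' _)] at h2
    refine (le_of_eq ?_).trans h2
    refine (Eq.trans ?_ e).trans ?_
    · rfl
    · refine lintegral_congr fun x => lintegral_congr fun t => ?_
      simp only [hKdef, Set.indicator, Set.mem_ofPred_eq]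
      rw [show x + phase l (θ + Real.pi) t + phase l θ t = x by rw [phase_add_pi]; ring, mul_comm]
  calc _ ≤ ∫⁻ x, ((∫⁻ t in {t | F (x + phase l θ t) ≤ G x}, F (x + phase l θ t) * G x ∂circ)
        + ∫⁻ t in {t | G x ≤ F (x + phase l θ t)}, F (x + phase l θ t) * G x ∂circ) := by
        refine lintegral_mono fun x => ?_
        refine le_trans ?_ (lintegral_union_le _ _ _)
        rw [← setLIntegral_univ]
        exact lintegral_mono_set fun t _ => le_total (F (x + phase l θ t)) (G x)
    _ = _ := by
        refine lintegral_add_left ?_ _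
        have hm (x : ℝ) : MeasurableSet {t | F (x + phase l θ t) ≤ G x} :=
          measurableSet_le (by fun_prop) measurable_const
        simp_rw [← lintegral_indicator (hm _)]
        have hK : Measurable fun z : ℝ × ℝ => {z : ℝ × ℝ | F (z.1 + phase l θ z.2) ≤ G z.1}.indicator
            (fun z => F (z.1 + phase l θ z.2) * G z.1) z :=
          (by fun_prop : Measurable fun z : ℝ × ℝ => F (z.1 + phase l θ z.2) * G z.1).indicator
            (measurableSet_le (by fun_prop) (by fun_prop))
        exact hK.lintegral_prod_right'
    _ ≤ 40 + 40 := add_le_add h1 e2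
    _ = 80 := by norm_num

/-! ### The trilinear form at M -/

/-- Only the phase linking `a` and `c` may degenerate on `S`; `h1` and `h2` say that the phases
linking `b` to `c` and to `a` do not. Hölder interpolates between a bound that uses the good phases,
with exponents `(5/6, 5/3, 5/6)`, and one that discards `b` and uses the bad phase, with exponents
`(5/4, 0, 5/4)`. -/
theorem lintegral_trilinear_le {a b c : ℝ → ℝ≥0∞} (ha : Measurable a) (hb : Measurable b)
    (hc : Measurable c) (ha1 : ∫⁻ u, a u ^ (5 / 3 : ℝ) ≤ 1) (hb1 : ∫⁻ u, b u ^ (5 / 3 : ℝ) ≤ 1)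
    (hc1 : ∫⁻ u, c u ^ (5 / 3 : ℝ) ≤ 1) {l : ℝ} (hl : 1 ≤ l) (θ : ℝ) {β : ℝ → ℝ}
    (hβ : Measurable β) {S : Set ℝ}
    (h1 : ∀ y, ∀ G : ℝ → ℝ≥0∞, ∫⁻ t in S, G (y - β t) ∂circ ≤ 16 * ∫⁻ u, G u)
    (h2 : ∀ y, ∀ G : ℝ → ℝ≥0∞,
      ∫⁻ t in S, G (y + (phase l θ t - β t)) ∂circ ≤ 16 * ∫⁻ u, G u) :
    ∫⁻ x, ∫⁻ t in S, a (x + phase l θ t) * b (x + β t) * c x ∂circ ≤ 1280 := by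
  set ν := circ.restrict S
  have q1 : ∫⁻ x, ∫⁻ t, a (x + phase l θ t) ^ (5 / 6 : ℝ) * b (x + β t) ^ (5 / 3 : ℝ)
      * c x ^ (5 / 6 : ℝ) ∂ν ≤ 16 := by
    rw [lintegral_lintegral_shift (γ := fun t => - β t)
      (K := fun x t => a (x + phase l θ t) ^ (5 / 6 : ℝ) * b (x + β t) ^ (5 / 3 : ℝ)
      * c x ^ (5 / 6 : ℝ)) (by unfold Function.uncurry; fun_prop) (by fun_prop)]
    calc _ ≤ ∫⁻ y, 16 * b y ^ (5 / 3 : ℝ) := by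
          refine lintegral_mono fun y => ?_
          have e : ∀ t, a (y + - β t + phase l θ t) ^ (5 / 6 : ℝ) * b (y + - β t + β t) ^ (5 / 3 : ℝ)
              * c (y + - β t) ^ (5 / 6 : ℝ) = b y ^ (5 / 3 : ℝ) *
              ((a (y + (phase l θ t - β t)) ^ (5 / 3 : ℝ)) ^ (1 / 2 : ℝ)
                * (c (y - β t) ^ (5 / 3 : ℝ)) ^ (1 / 2 : ℝ)) := fun t => by
            rw [← ENNReal.rpow_mul, ← ENNReal.rpow_mul, neg_add_cancel_right,
              show y + - β t + phase l θ t = y + (phase l θ t - β t) by ring,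
              ← sub_eq_add_neg y, show (5 / 3 * (1 / 2) : ℝ) = 5 / 6 by norm_num]
            ring
          simp_rw [e]
          -- Centred at `b`, the inner integral no longer involves `b`; Cauchy–Schwarz separates `a`
          -- from `c`, each carried by a nondegenerate phase.
          rw [lintegral_const_mul _ (by fun_prop), mul_comm]
          refine mul_le_mul' ?_ le_rfl
          calc _ ≤ (∫⁻ t, a (y + (phase l θ t - β t)) ^ (5 / 3 : ℝ) ∂ν) ^ (1 / 2 : ℝ)
                * (∫⁻ t, c (y - β t) ^ (5 / 3 : ℝ) ∂ν) ^ (1 / 2 : ℝ) :=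
                ENNReal.lintegral_mul_norm_pow_le (by fun_prop) (by fun_prop) (by norm_num)
                  (by norm_num) (by norm_num)
            _ ≤ (16 * 1) ^ (1 / 2 : ℝ) * (16 * 1) ^ (1 / 2 : ℝ) := by
                gcongr
                · exact (h2 y fun u => a u ^ (5 / 3 : ℝ)).trans (by gcongr)
                · exact (h1 y fun u => c u ^ (5 / 3 : ℝ)).trans (by gcongr)
            _ = 16 := by
                rw [← ENNReal.rpow_add_of_nonneg _ _ (by norm_num) (by norm_num)]; norm_num
      _ = 16 * ∫⁻ y, b y ^ (5 / 3 : ℝ) := lintegral_const_mul' _ _ (by simp)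
      _ ≤ 16 * 1 := by gcongr
      _ = 16 := by norm_num
  -- Since `5/4 · 4/3 = 5/3`, the functions `a^{5/4}` and `c^{5/4}` are normalised in `L^{4/3}`; the
  -- restriction to `S` is dropped.
  have q2 : ∫⁻ x, ∫⁻ t, a (x + phase l θ t) ^ (5 / 4 : ℝ) * c x ^ (5 / 4 : ℝ) ∂ν ≤ 80 := by
    refine (lintegral_mono fun x => setLIntegral_le_lintegral _ _).trans
      (lintegral_phase_pair_le (F := fun u => a u ^ (5 / 4 : ℝ)) (G := fun u => c u ^ (5 / 4 : ℝ))
        (by fun_prop) (by fun_prop) ?_ ?_ hl θ)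
    · simp_rw [← ENNReal.rpow_mul]; norm_num; exact ha1
    · simp_rw [← ENNReal.rpow_mul]; norm_num; exact hc1
  rw [lintegral_lintegral (by unfold Function.uncurry; fun_prop)] at q1 q2 ⊢
  calc _ = ∫⁻ z, (a (z.1 + phase l θ z.2) ^ (5 / 6 : ℝ) * b (z.1 + β z.2) ^ (5 / 3 : ℝ)
      * c z.1 ^ (5 / 6 : ℝ)) ^ (3 / 5 : ℝ) *
        (a (z.1 + phase l θ z.2) ^ (5 / 4 : ℝ) * c z.1 ^ (5 / 4 : ℝ)) ^ (2 / 5 : ℝ)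
        ∂(volume.prod ν) := by
        refine lintegral_congr fun z => ?_
        have half : ∀ w : ℝ≥0∞, w ^ (1 / 2 : ℝ) * w ^ (1 / 2 : ℝ) = w := fun w => by
          rw [← ENNReal.rpow_add_of_nonneg _ _ (by norm_num) (by norm_num)]; norm_num
        simp only [ENNReal.mul_rpow_of_nonneg _ _ (by norm_num : (0 : ℝ) ≤ 3 / 5),
          ENNReal.mul_rpow_of_nonneg _ _ (by norm_num : (0 : ℝ) ≤ 2 / 5), ← ENNReal.rpow_mul]
        rw [show (5 / 6 * (3 / 5) : ℝ) = 1 / 2 by norm_num,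
          show (5 / 4 * (2 / 5) : ℝ) = 1 / 2 by norm_num,
          show (5 / 3 * (3 / 5) : ℝ) = 1 by norm_num, ENNReal.rpow_one]
        nth_rw 1 [← half (a (z.1 + phase l θ z.2)), ← half (c z.1)]
        ring
    _ ≤ _ := ENNReal.lintegral_mul_norm_pow_le (by fun_prop) (by fun_prop) (by norm_num)
        (by norm_num) (by norm_num)
    _ ≤ 16 ^ (3 / 5 : ℝ) * 80 ^ (2 / 5 : ℝ) := by gcongr
    _ ≤ 16 * 80 := by
        gcongr <;> exact rpow_le_self_of_one_le (by norm_num) (by norm_num)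
    _ = 1280 := by norm_num

/-! ### The positive operator and its three phases -/

/-- The operator `T` on `[0, ∞]`-valued functions. -/
noncomputable def posT (F G : ℝ → ℝ≥0∞) (x : ℝ) : ℝ≥0∞ :=
  ∫⁻ t, F (x - Real.cos t) * G (x - Real.sin t) ∂circ

theorem measurable_posT {F G : ℝ → ℝ≥0∞} (hF : Measurable F) (hG : Measurable G) :
    Measurable (posT F G) :=
  (by fun_prop : Measurable fun z : ℝ × ℝ => F (z.1 - Real.cos z.2) * G (z.1 - Real.sin z.2)).lintegral_prod_right'

theorem phase_one_pi (t : ℝ) : phase 1 Real.pi t = - Real.cos t := by simp [phase]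

theorem phase_one_pi_div_two (t : ℝ) : phase 1 (Real.pi / 2) t = - Real.sin t := by
  simp [phase, Real.cos_add_pi_div_two]

theorem phase_one_neg_pi_div_two (t : ℝ) : phase 1 (-(Real.pi / 2)) t = Real.sin t := by
  simp [phase, ← sub_eq_add_neg, Real.cos_sub_pi_div_two]

theorem phase_one_zero (t : ℝ) : phase 1 0 t = Real.cos t := by simp [phase]

theorem sqrt_two_mul_half_sqrt_two : √2 * (√2 / 2) = 1 := by
  rw [← mul_div_assoc, Real.mul_self_sqrt (by norm_num)]; norm_num

theorem phase_sqrt_two_pi_div_four (t : ℝ) :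
    phase (√2) (Real.pi / 4) t = Real.cos t - Real.sin t := by
  rw [phase, Real.cos_add, Real.cos_pi_div_four, Real.sin_pi_div_four]
  linear_combination (Real.cos t - Real.sin t) * sqrt_two_mul_half_sqrt_two

theorem phase_sqrt_two_five_pi_div_four (t : ℝ) :
    phase (√2) (Real.pi / 4 + Real.pi) t = Real.sin t - Real.cos t := by
  rw [phase_add_pi, phase_sqrt_two_pi_div_four]; ring

theorem one_le_sqrt_two : 1 ≤ √2 := Real.one_le_sqrt.2 (by norm_num)

theorem setLIntegral_cos_le (G : ℝ → ℝ≥0∞) (y : ℝ) {S : Set ℝ} (hS : MeasurableSet S)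
    (h : ∀ t ∈ S, 1 / 4 ≤ |Real.sin t|) :
    ∫⁻ t in S, G (y + Real.cos t) ∂circ ≤ 16 * ∫⁻ u, G u := by
  have := setLIntegral_phase_le_of_le_abs_sin G le_rfl 0 y hS fun t ht => by
    rw [add_zero]; linarith [h t ht]
  simpa only [phase_one_zero] using this

theorem setLIntegral_sub_cos_le (G : ℝ → ℝ≥0∞) (y : ℝ) {S : Set ℝ} (hS : MeasurableSet S)
    (h : ∀ t ∈ S, 1 / 4 ≤ |Real.sin t|) :
    ∫⁻ t in S, G (y - Real.cos t) ∂circ ≤ 16 * ∫⁻ u, G u := by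
  have := setLIntegral_phase_le_of_le_abs_sin G le_rfl Real.pi y hS fun t ht => by
    rw [Real.sin_add_pi, abs_neg]; linarith [h t ht]
  simpa only [phase_one_pi, ← sub_eq_add_neg] using this

theorem setLIntegral_sin_le (G : ℝ → ℝ≥0∞) (y : ℝ) {S : Set ℝ} (hS : MeasurableSet S)
    (h : ∀ t ∈ S, 1 / 4 ≤ |Real.cos t|) :
    ∫⁻ t in S, G (y + Real.sin t) ∂circ ≤ 16 * ∫⁻ u, G u := by
  have := setLIntegral_phase_le_of_le_abs_sin G le_rfl (-(Real.pi / 2)) y hS fun t ht => by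
    rw [← sub_eq_add_neg, Real.sin_sub_pi_div_two, abs_neg]; linarith [h t ht]
  simpa only [phase_one_neg_pi_div_two] using this

theorem setLIntegral_sub_sin_le (G : ℝ → ℝ≥0∞) (y : ℝ) {S : Set ℝ} (hS : MeasurableSet S)
    (h : ∀ t ∈ S, 1 / 4 ≤ |Real.cos t|) :
    ∫⁻ t in S, G (y - Real.sin t) ∂circ ≤ 16 * ∫⁻ u, G u := by
  have := setLIntegral_phase_le_of_le_abs_sin G le_rfl (Real.pi / 2) y hS fun t ht => by
    rw [Real.sin_add_pi_div_two]; linarith [h t ht]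
  simpa only [phase_one_pi_div_two, ← sub_eq_add_neg] using this

theorem abs_sin_add_pi_div_four_ge {t : ℝ} (h : 1 / 4 ≤ |Real.sin t + Real.cos t|) :
    1 / 8 ≤ |Real.sin (t + Real.pi / 4)| := by
  rw [Real.sin_add, Real.cos_pi_div_four, Real.sin_pi_div_four, ← add_mul, abs_mul,
    abs_of_nonneg (by positivity : (0 : ℝ) ≤ √2 / 2)]
  nlinarith [one_le_sqrt_two]

theorem setLIntegral_cos_sub_sin_le (G : ℝ → ℝ≥0∞) (y : ℝ) {S : Set ℝ} (hS : MeasurableSet S)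
    (h : ∀ t ∈ S, 1 / 4 ≤ |Real.sin t + Real.cos t|) :
    ∫⁻ t in S, G (y + (Real.cos t - Real.sin t)) ∂circ ≤ 16 * ∫⁻ u, G u := by
  have := setLIntegral_phase_le_of_le_abs_sin G one_le_sqrt_two (Real.pi / 4) y hS fun t ht =>
    abs_sin_add_pi_div_four_ge (h t ht)
  simpa only [phase_sqrt_two_pi_div_four] using this

theorem setLIntegral_sin_sub_cos_le (G : ℝ → ℝ≥0∞) (y : ℝ) {S : Set ℝ} (hS : MeasurableSet S)
    (h : ∀ t ∈ S, 1 / 4 ≤ |Real.sin t + Real.cos t|) :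
    ∫⁻ t in S, G (y + (Real.sin t - Real.cos t)) ∂circ ≤ 16 * ∫⁻ u, G u := by
  have := setLIntegral_phase_le_of_le_abs_sin G one_le_sqrt_two (Real.pi / 4 + Real.pi) y hS
    fun t ht => by
      rw [← add_assoc, Real.sin_add_pi, abs_neg]
      exact abs_sin_add_pi_div_four_ge (h t ht)
  simpa only [phase_sqrt_two_five_pi_div_four] using this

/-- Two of the three Jacobians are bounded below at every point of the circle. -/
theorem jacobian_cases (t : ℝ) :
    (1 / 4 ≤ |Real.cos t| ∧ 1 / 4 ≤ |Real.sin t + Real.cos t|) ∨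
    (1 / 4 ≤ |Real.sin t| ∧ 1 / 4 ≤ |Real.sin t + Real.cos t|) ∨
    (1 / 4 ≤ |Real.sin t| ∧ 1 / 4 ≤ |Real.cos t|) := by
  have h := Real.sin_sq_add_cos_sq t
  set s := Real.sin t
  set c := Real.cos t
  by_contra! hcon
  obtain ⟨h1, h2, h3⟩ := hcon
  -- If two of the three quantities are below 1/4, then among `sin` and `cos` one is below 1/4 and
  -- the other below 1/2, which contradicts `sin² + cos² = 1`.
  have key : ∀ a b : ℝ, |a| < 1 / 4 → |b| < 1 / 2 → a ^ 2 + b ^ 2 = 1 → False := by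
    intro a b ha hb hab
    have ha' := sq_lt_sq' (by linarith [abs_nonneg a]) ha
    have hb' := sq_lt_sq' (by linarith [abs_nonneg b]) hb
    rw [sq_abs] at ha' hb'
    norm_num at ha' hb'
    linarith
  have t1 : |s| ≤ |s + c| + |c| := by simpa using abs_sub (s + c) c
  have t2 : |c| ≤ |s + c| + |s| := by simpa using abs_sub (s + c) s
  by_cases hs : 1 / 4 ≤ |s|
  · have hsc := h2 hs
    have hc := h3 hs
    exact key c s hc (by linarith) (by linarith)
  · push Not at hs
    by_cases hc : 1 / 4 ≤ |c|
    · exact key s c hs (by linarith [h1 hc]) h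
    · push Not at hc
      exact key s c hs (by linarith) h

theorem lintegral_posT_mul {F G H : ℝ → ℝ≥0∞} (hF : Measurable F) (hG : Measurable G) :
    ∫⁻ x, posT F G x * H x
      = ∫⁻ x, ∫⁻ t, F (x - Real.cos t) * G (x - Real.sin t) * H x ∂circ := by
  refine lintegral_congr fun x => ?_
  rw [posT, lintegral_mul_const _ (by fun_prop)]

/-- The form centred at `G`. This is the useful view when `G` is only in `L¹`: a bound on the inner
integral uniform in `y` is then all that is needed. -/
theorem lintegral_posT_mul' {F G H : ℝ → ℝ≥0∞} (hF : Measurable F) (hG : Measurable G)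
    (hH : Measurable H) :
    ∫⁻ x, posT F G x * H x = ∫⁻ y, G y *
      ∫⁻ t, F (y + (Real.sin t - Real.cos t)) * H (y + Real.sin t) ∂circ := by
  rw [lintegral_posT_mul hF hG, lintegral_lintegral_shift (γ := Real.sin)
    (K := fun x t => F (x - Real.cos t) * G (x - Real.sin t) * H x)
    (by unfold Function.uncurry; fun_prop) (by fun_prop)]
  refine lintegral_congr fun y => ?_
  rw [← lintegral_const_mul _ (by fun_prop)]
  refine lintegral_congr fun t => ?_
  rw [add_sub_cancel_right, ← add_sub_assoc]
  ring

/-- The circle is covered by three sets, each with two good phases. On each,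
`lintegral_trilinear_le` is applied with the two functions linked by the remaining phase in the
roles of `a` and `c`. -/
theorem lintegral_posT_mul_le {F G H : ℝ → ℝ≥0∞} (hF : Measurable F) (hG : Measurable G)
    (hH : Measurable H) (hF1 : ∫⁻ u, F u ^ (5 / 3 : ℝ) ≤ 1) (hG1 : ∫⁻ u, G u ^ (5 / 3 : ℝ) ≤ 1)
    (hH1 : ∫⁻ u, H u ^ (5 / 3 : ℝ) ≤ 1) :
    ∫⁻ x, posT F G x * H x ≤ 3840 := by
  set Vs : Set ℝ := {t | 1 / 4 ≤ |Real.sin t|} with hVs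
  set Vc : Set ℝ := {t | 1 / 4 ≤ |Real.cos t|} with hVc
  set Vd : Set ℝ := {t | 1 / 4 ≤ |Real.sin t + Real.cos t|} with hVd
  have ms : MeasurableSet Vs := measurableSet_le measurable_const (by fun_prop)
  have mc : MeasurableSet Vc := measurableSet_le measurable_const (by fun_prop)
  have md : MeasurableSet Vd := measurableSet_le measurable_const (by fun_prop)
  have m1 : MeasurableSet (Vc ∩ Vd) := mc.inter md
  have m2 : MeasurableSet (Vs ∩ Vd) := ms.inter md
  have m3 : MeasurableSet (Vs ∩ Vc) := ms.inter mc
  set K : ℝ → ℝ → ℝ≥0∞ := fun x t => F (x - Real.cos t) * G (x - Real.sin t) * H x with hK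
  have hKm : Measurable (Function.uncurry K) := by unfold Function.uncurry; fun_prop
  have e1 : ∫⁻ x, ∫⁻ t in Vc ∩ Vd, K x t ∂circ ≤ 1280 := by
    have := lintegral_trilinear_le hF hG hH hF1 hG1 hH1 le_rfl Real.pi (β := fun t => - Real.sin t)
      (by fun_prop) (S := Vc ∩ Vd)
      (fun y P => by
        simpa only [sub_neg_eq_add] using setLIntegral_sin_le P y m1 fun t ht => ht.1)
      (fun y P => by
        simpa only [phase_one_pi, neg_sub_neg] using
          setLIntegral_sin_sub_cos_le P y m1 fun t ht => ht.2)
    simpa only [phase_one_pi, ← sub_eq_add_neg] using this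
  have e2 : ∫⁻ x, ∫⁻ t in Vs ∩ Vd, K x t ∂circ ≤ 1280 := by
    have := lintegral_trilinear_le hG hF hH hG1 hF1 hH1 le_rfl (Real.pi / 2)
      (β := fun t => - Real.cos t) (by fun_prop) (S := Vs ∩ Vd)
      (fun y P => by
        simpa only [sub_neg_eq_add] using setLIntegral_cos_le P y m2 fun t ht => ht.1)
      (fun y P => by
        simpa only [phase_one_pi_div_two, neg_sub_neg] using
          setLIntegral_cos_sub_sin_le P y m2 fun t ht => ht.2)
    simpa only [phase_one_pi_div_two, ← sub_eq_add_neg, hK, mul_comm (F _)] using this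
  -- Here the possibly degenerate phase is `sin t - cos t`, linking `F` and `G`, so the form is
  -- recentred at `G`.
  have e3 : ∫⁻ x, ∫⁻ t in Vs ∩ Vc, K x t ∂circ ≤ 1280 := by
    have := lintegral_trilinear_le hF hH hG hF1 hH1 hG1 one_le_sqrt_two (Real.pi / 4 + Real.pi)
      (β := Real.sin) (by fun_prop) (S := Vs ∩ Vc)
      (fun y P => setLIntegral_sub_sin_le P y m3 fun t ht => ht.2)
      (fun y P => by
        have := setLIntegral_sub_cos_le P y m3 fun t ht => ht.1
        simpa only [phase_sqrt_two_five_pi_div_four, sub_sub_cancel_left, ← sub_eq_add_neg]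
          using this)
    rw [lintegral_lintegral_shift (ν := circ.restrict (Vs ∩ Vc)) hKm (γ := Real.sin) (by fun_prop)]
    refine (le_of_eq ?_).trans this
    refine lintegral_congr fun y => lintegral_congr fun t => ?_
    simp only [hK]
    rw [phase_sqrt_two_five_pi_div_four, add_sub_cancel_right, ← add_sub_assoc]
    ring
  have meas (U : Set ℝ) : Measurable fun x => ∫⁻ t in U, K x t ∂circ :=
    hKm.lintegral_prod_right'
  rw [lintegral_posT_mul hF hG]
  calc _ ≤ ∫⁻ x, ((∫⁻ t in Vc ∩ Vd, K x t ∂circ) + ((∫⁻ t in Vs ∩ Vd, K x t ∂circ)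
        + ∫⁻ t in Vs ∩ Vc, K x t ∂circ)) := by
        refine lintegral_mono fun x => ?_
        refine le_trans ?_ ((lintegral_union_le _ (Vc ∩ Vd) ((Vs ∩ Vd) ∪ (Vs ∩ Vc))).trans
          (add_le_add le_rfl (lintegral_union_le _ _ _)))
        rw [← setLIntegral_univ]
        exact lintegral_mono_set fun t _ => jacobian_cases t
    _ = _ := by rw [lintegral_add_left (meas (Vc ∩ Vd)), lintegral_add_left (meas (Vs ∩ Vd))]
    _ ≤ 1280 + (1280 + 1280) := by gcongr
    _ = 3840 := by norm_num

/-! ### Duality and reduction to nonnegative functions -/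

theorem lintegral_rpow_le_of_dual {p q : ℝ} (hpq : p.HolderConjugate q) {A : ℝ → ℝ≥0∞}
    (hA : Measurable A) {C : ℝ≥0∞}
    (h : ∀ H : ℝ → ℝ≥0∞, Measurable H → ∫⁻ x, H x ^ q ≤ 1 → ∫⁻ x, A x * H x ≤ C) :
    ∫⁻ x, A x ^ p ≤ C ^ p := by
  have hp := hpq.pos
  have hq := hpq.symm.pos
  have hp1 := hpq.lt
  -- Truncation in height and in space makes the `L^p` integral finite, so that it may be divided
  -- out; Fatou removes the truncation.
  set B : ℕ → ℝ → ℝ≥0∞ := fun n => (Set.Icc (-(n : ℝ)) n).indicator fun x => min (A x) n with hB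
  have hBm (n : ℕ) : Measurable (B n) := (hA.min measurable_const).indicator measurableSet_Icc
  have hBA (n : ℕ) (x : ℝ) : B n x ≤ A x :=
    Set.indicator_apply_le' (fun _ => min_le_left _ _) fun _ => zero_le
  have hBle (n : ℕ) (x : ℝ) : B n x ≤ n :=
    Set.indicator_apply_le' (fun _ => min_le_right _ _) fun _ => zero_le
  have bound (n : ℕ) : ∫⁻ x, B n x ^ p ≤ C ^ p := by
    set b := ∫⁻ x, B n x ^ p with hb
    rcases eq_or_ne b 0 with h0 | h0
    · rw [h0]; exact zero_le
    have ht : b ≠ ∞ := by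
      refine ne_top_of_le_ne_top (b := (n : ℝ≥0∞) ^ p * volume (Set.Icc (-(n : ℝ)) n)) ?_ ?_
      · exact ENNReal.mul_ne_top (ENNReal.rpow_ne_top_of_nonneg hp.le (by simp)) (by simp)
      · rw [hb, ← setLIntegral_const, ← lintegral_indicator measurableSet_Icc]
        refine lintegral_mono fun x => ?_
        by_cases hx : x ∈ Set.Icc (-(n : ℝ)) n
        · rw [Set.indicator_of_mem hx]
          exact ENNReal.rpow_le_rpow (hBle n x) hp.le
        · rw [Set.indicator_of_notMem hx, hB]
          simp only [Set.indicator_of_notMem hx, ENNReal.zero_rpow_of_pos hp, le_refl]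
    -- The extremiser in Hölder's inequality, `B^{p-1}` normalised in `L^q`.
    have hH := h (fun x => B n x ^ (p - 1) * b ^ (-(1 / q))) (by fun_prop) (by
      simp only [ENNReal.mul_rpow_of_nonneg _ _ hq.le, ← ENNReal.rpow_mul]
      rw [hpq.sub_one_mul_conj, neg_mul, one_div, inv_mul_cancel₀ hq.ne',
        lintegral_mul_const _ (by fun_prop), ENNReal.rpow_neg_one, ENNReal.mul_inv_cancel h0 ht])
    have h1 : b ^ (1 / p) ≤ C := by
      refine le_trans ?_ hH
      calc b ^ (1 / p) = b * b ^ (-(1 / q)) := by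
            nth_rw 2 [← ENNReal.rpow_one b]
            rw [← ENNReal.rpow_add _ _ h0 ht]
            congr 1
            have := hpq.inv_add_inv_eq_one
            rw [one_div, one_div]; linarith
        _ = ∫⁻ x, B n x * (B n x ^ (p - 1) * b ^ (-(1 / q))) := by
            rw [hb, ← lintegral_mul_const _ (by fun_prop)]
            refine lintegral_congr fun x => ?_
            rw [← mul_assoc]
            congr 1
            nth_rw 2 [← ENNReal.rpow_one (B n x)]
            rw [← ENNReal.rpow_add_of_nonneg _ _ zero_le_one (by linarith)]
            congr 1; ring
        _ ≤ _ := lintegral_mono fun x => mul_le_mul' (hBA n x) le_rfl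
    calc b = (b ^ (1 / p)) ^ p := by rw [← ENNReal.rpow_mul, one_div_mul_cancel hp.ne', ENNReal.rpow_one]
      _ ≤ C ^ p := ENNReal.rpow_le_rpow h1 hp.le
  have lim (x : ℝ) : Filter.Tendsto (fun n => B n x ^ p) Filter.atTop (nhds (A x ^ p)) := by
    refine (ENNReal.continuous_rpow_const.tendsto _).comp ?_
    have h1 : Filter.Tendsto (fun n : ℕ => min (A x) (n : ℝ≥0∞)) Filter.atTop (nhds (A x)) := by
      simpa using (tendsto_const_nhds (x := A x)).min ENNReal.tendsto_nat_nhds_top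
    refine h1.congr' ?_
    filter_upwards [Filter.eventually_ge_atTop ⌈|x|⌉₊] with n hn
    have : |x| ≤ n := Nat.ceil_le.1 hn
    simp only [hB]
    rw [Set.indicator_of_mem (Set.mem_Icc.2 (abs_le.1 this))]
  calc ∫⁻ x, A x ^ p = ∫⁻ x, Filter.liminf (fun n => B n x ^ p) Filter.atTop :=
        lintegral_congr fun x => (lim x).liminf_eq.symm
    _ ≤ Filter.liminf (fun n => ∫⁻ x, B n x ^ p) Filter.atTop :=
        lintegral_liminf_le fun n => by fun_prop
    _ ≤ C ^ p := Filter.liminf_le_of_le (by isBoundedDefault) fun c hc => by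
        obtain ⟨n, hn⟩ := hc.exists
        exact hn.trans (bound n)

/-- For fixed `t` the translate of a null set is null, so Fubini gives null sections in `t` for
almost every `x`. Thus `T`, although an integral along a curve, respects almost-everywhere equality.
-/
theorem ae_ae_comp_sub {P : ℝ → Prop} (hP : ∀ᵐ u, P u) {γ : ℝ → ℝ} (hγ : Measurable γ) :
    ∀ᵐ x, ∀ᵐ t ∂circ, P (x - γ t) := by
  set N := toMeasurable volume {u | ¬ P u} with hN
  have hNm : MeasurableSet N := measurableSet_toMeasurable _ _
  have hN0 : volume N = 0 := by rw [hN, measure_toMeasurable]; exact ae_iff.1 hP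
  set K : ℝ → ℝ → ℝ≥0∞ := fun x t => N.indicator 1 (x - γ t) with hK
  have h1 : Measurable (N.indicator (1 : ℝ → ℝ≥0∞)) := measurable_one.indicator hNm
  have hKm : Measurable (Function.uncurry K) :=
    h1.comp (by fun_prop : Measurable fun z : ℝ × ℝ => z.1 - γ z.2)
  have h0 : ∫⁻ x, ∫⁻ t, K x t ∂circ = 0 := by
    rw [lintegral_lintegral_shift hKm hγ]
    simp only [hK, add_sub_cancel_right, lintegral_const]
    rw [lintegral_mul_const _ h1, lintegral_indicator_one hNm, hN0, zero_mul]
  have hKi : Measurable fun x => ∫⁻ t, K x t ∂circ := hKm.lintegral_prod_right'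
  rw [lintegral_eq_zero_iff hKi] at h0
  filter_upwards [h0] with x hx
  have hx' : ∫⁻ t, K x t ∂circ = 0 := hx
  have hKx : Measurable fun t => K x t := hKm.comp measurable_prodMk_left
  rw [lintegral_eq_zero_iff hKx] at hx'
  filter_upwards [hx'] with t ht
  by_contra hcon
  have hmem : x - γ t ∈ N := subset_toMeasurable _ _ hcon
  simp [hK, Set.indicator_of_mem hmem] at ht

theorem posT_mono_ae {F F' G G' : ℝ → ℝ≥0∞} (hF : ∀ᵐ u, F u ≤ F' u) (hG : ∀ᵐ u, G u ≤ G' u) :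
    ∀ᵐ x, posT F G x ≤ posT F' G' x := by
  filter_upwards [ae_ae_comp_sub hF Real.measurable_cos, ae_ae_comp_sub hG Real.measurable_sin]
    with x h1 h2
  refine lintegral_mono_ae ?_
  filter_upwards [h1, h2] with t h1 h2 using mul_le_mul' h1 h2

theorem two_pi_pos_le : (0 : ℝ) ≤ 2 * Real.pi := Real.two_pi_pos.le

theorem enorm_T_le (f g : ℝ → ℂ) (x : ℝ) :
    ‖T f g x‖ₑ ≤ posT (fun u => ‖f u‖ₑ) (fun u => ‖g u‖ₑ) x := by
  rw [T, intervalIntegral.integral_of_le two_pi_pos_le]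
  refine (enorm_integral_le_lintegral_enorm _).trans_eq ?_
  simp only [integrand, enorm_mul, posT]

/-- The norm bound is asked for every `u` dominated by the positive operator, so convergence,
measurability and the passage to measurable representatives are settled once for all the positive
results. -/
theorem isBoundedBetween_of_posT {N₁ N₂ N : (ℝ → ℂ) → ℝ≥0∞}
    (h₁ : ∀ f g : ℝ → ℂ, f =ᵐ[volume] g → N₁ f = N₁ g)
    (h₂ : ∀ f g : ℝ → ℂ, f =ᵐ[volume] g → N₂ f = N₂ g) (C : ℝ≥0)
    (h : ∀ f g : ℝ → ℂ, Measurable f → Measurable g → N₁ f < ∞ → N₂ g < ∞ →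
      (∀ᵐ x, posT (fun u => ‖f u‖ₑ) (fun u => ‖g u‖ₑ) x < ∞) ∧
      ∀ u : ℝ → ℂ, (∀ᵐ x, ‖u x‖ₑ ≤ posT (fun u => ‖f u‖ₑ) (fun u => ‖g u‖ₑ) x) →
        N u ≤ C * N₁ f * N₂ g) :
    IsBoundedBetween N₁ N₂ N := by
  refine ⟨C, fun f₁ f₂ hf₁ hf₂ hN₁ hN₂ => ?_⟩
  set g₁ := hf₁.mk f₁
  set g₂ := hf₂.mk f₂
  have m₁ : Measurable g₁ := hf₁.stronglyMeasurable_mk.measurable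
  have m₂ : Measurable g₂ := hf₂.stronglyMeasurable_mk.measurable
  rw [h₁ _ _ hf₁.ae_eq_mk] at hN₁ ⊢
  rw [h₂ _ _ hf₂.ae_eq_mk] at hN₂ ⊢
  obtain ⟨hfin, hbd⟩ := h g₁ g₂ m₁ m₂ hN₁ hN₂
  have hae : ∀ᵐ x, integrand f₁ f₂ x =ᵐ[circ] integrand g₁ g₂ x := by
    filter_upwards [ae_ae_comp_sub hf₁.ae_eq_mk Real.measurable_cos,
      ae_ae_comp_sub hf₂.ae_eq_mk Real.measurable_sin] with x h1 h2
    filter_upwards [h1, h2] with t h1 h2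
    simp only [integrand, h1, h2, g₁, g₂]
  have hT : T f₁ f₂ =ᵐ[volume] T g₁ g₂ := by
    filter_upwards [hae] with x hx
    rw [T, T, intervalIntegral.integral_of_le two_pi_pos_le,
      intervalIntegral.integral_of_le two_pi_pos_le]
    exact integral_congr_ae hx
  have hm : Measurable (Function.uncurry (integrand g₁ g₂)) := by
    unfold Function.uncurry integrand; fun_prop
  refine ⟨?_, ?_, ?_⟩
  · filter_upwards [hae, hfin] with x hx hx'
    rw [intervalIntegrable_iff_integrableOn_Ioc_of_le two_pi_pos_le]
    refine Integrable.congr ?_ hx.symm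
    refine ⟨(hm.comp measurable_prodMk_left).aestronglyMeasurable, ?_⟩
    refine lt_of_eq_of_lt ?_ hx'
    simp only [integrand, enorm_mul, posT]
  · refine AEStronglyMeasurable.congr ?_ hT.symm
    have : T g₁ g₂ = fun x => ∫ t, integrand g₁ g₂ x t ∂circ := by
      funext x
      rw [T, intervalIntegral.integral_of_le two_pi_pos_le]
    rw [this]
    exact (hm.stronglyMeasurable.integral_prod_right').aestronglyMeasurable
  · refine hbd _ ?_
    filter_upwards [hT] with x hx
    rw [hx]
    exact enorm_T_le _ _ _

theorem distrib_congr {f g : ℝ → ℂ} (h : f =ᵐ[volume] g) (s : ℝ) : distrib f s = distrib g s := by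
  refine measure_congr ?_
  filter_upwards [h] with x hx
  exact congrArg (fun z : ℂ => s < ‖z‖) hx

theorem lorentzOneNorm_congr {p : ℝ≥0∞} {f g : ℝ → ℂ} (h : f =ᵐ[volume] g) :
    lorentzOneNorm p f = lorentzOneNorm p g := by
  simp only [lorentzOneNorm, eLpNorm_congr_ae h, distrib_congr h]

/-! ### Strong type at O, C and M -/

theorem circ_univ_le : circ Set.univ ≤ 8 := by
  rw [Measure.restrict_apply_univ, Real.volume_Ioc, ← ENNReal.ofReal_ofNat 8]
  exact ENNReal.ofReal_le_ofReal (by linarith [Real.pi_le_four])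

theorem ae_enorm_le_eLpNorm_top (f : ℝ → ℂ) : ∀ᵐ u, ‖f u‖ₑ ≤ eLpNorm f ∞ volume := by
  rw [eLpNorm_exponent_top]
  exact ae_le_eLpNormEssSup

theorem posT_const_left (M : ℝ≥0∞) {G : ℝ → ℝ≥0∞} (hG : Measurable G) (x : ℝ) :
    posT (fun _ => M) G x = M * ∫⁻ t, G (x - Real.sin t) ∂circ :=
  lintegral_const_mul _ (by fun_prop)

theorem lintegral_posT_mul_le_of_forall {F G H : ℝ → ℝ≥0∞} (hF : Measurable F) (hG : Measurable G)
    (hH : Measurable H) {M : ℝ≥0∞}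
    (h : ∀ y, ∫⁻ t, F (y + (Real.sin t - Real.cos t)) * H (y + Real.sin t) ∂circ ≤ M) :
    ∫⁻ x, posT F G x * H x ≤ M * ∫⁻ y, G y := by
  rw [lintegral_posT_mul' hF hG hH, mul_comm M, ← lintegral_mul_const _ hG]
  exact lintegral_mono fun y => mul_le_mul' le_rfl (h y)

theorem lintegral_posT_const_le (M : ℝ≥0∞) {G : ℝ → ℝ≥0∞} (hG : Measurable G) :
    ∫⁻ x, posT (fun _ => M) G x ≤ M * 8 * ∫⁻ y, G y := by
  have := lintegral_posT_mul_le_of_forall (F := fun _ => M) (H := fun _ => 1) measurable_const hG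
    measurable_const (M := M * 8) fun y => by
      rw [mul_one, lintegral_const]
      exact mul_le_mul' le_rfl circ_univ_le
  simpa using this

theorem isStrongType_O : IsStrongType ∞ ∞ ∞ := by
  refine isBoundedBetween_of_posT (fun f g h => eLpNorm_congr_ae h)
    (fun f g h => eLpNorm_congr_ae h) 8 fun f g hf hg hNf hNg => ?_
  have key : ∀ᵐ x, posT (fun u => ‖f u‖ₑ) (fun u => ‖g u‖ₑ) x
      ≤ 8 * eLpNorm f ∞ volume * eLpNorm g ∞ volume := by
    filter_upwards [posT_mono_ae (ae_enorm_le_eLpNorm_top f) (ae_enorm_le_eLpNorm_top g)] with x hx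
    refine hx.trans ?_
    rw [posT_const_left _ measurable_const, lintegral_const]
    calc _ ≤ eLpNorm f ∞ volume * (eLpNorm g ∞ volume * 8) := by gcongr; exact circ_univ_le
      _ = _ := by ring
  refine ⟨?_, fun u hu => ?_⟩
  · filter_upwards [key] with x hx
    exact hx.trans_lt (ENNReal.mul_lt_top (ENNReal.mul_lt_top (by simp) hNf) hNg)
  · simp only [eLpNorm_exponent_top (f := u)]
    refine eLpNormEssSup_le_of_ae_enorm_bound ?_
    filter_upwards [key, hu] with x h1 h2 using h2.trans h1

theorem isStrongType_C : IsStrongType ∞ 1 1 := by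
  refine isBoundedBetween_of_posT (fun f g h => eLpNorm_congr_ae h)
    (fun f g h => eLpNorm_congr_ae h) 8 fun f g hf hg hNf hNg => ?_
  have key : ∫⁻ x, posT (fun u => ‖f u‖ₑ) (fun u => ‖g u‖ₑ) x
      ≤ 8 * eLpNorm f ∞ volume * eLpNorm g 1 volume := by
    refine (lintegral_mono_ae (posT_mono_ae (ae_enorm_le_eLpNorm_top f)
      (.of_forall fun _ => le_rfl))).trans ?_
    rw [eLpNorm_one_eq_lintegral_enorm, mul_comm 8]
    exact lintegral_posT_const_le _ (by fun_prop)
  refine ⟨?_, fun u hu => ?_⟩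
  · exact ae_lt_top (measurable_posT (by fun_prop) (by fun_prop)) (ne_top_of_le_ne_top
      (ENNReal.mul_lt_top (ENNReal.mul_lt_top (by simp) hNf) hNg).ne key)
  · simp only [eLpNorm_one_eq_lintegral_enorm (f := u)]
    exact (lintegral_mono_ae hu).trans key

theorem ae_lt_top_of_lintegral_rpow {A : ℝ → ℝ≥0∞} (hA : Measurable A) {p : ℝ} (hp : 0 < p)
    (h : ∫⁻ x, A x ^ p ≠ ∞) : ∀ᵐ x, A x < ∞ := by
  filter_upwards [ae_lt_top (by fun_prop) h] with x hx
  exact (ENNReal.rpow_lt_top_iff_of_pos hp).1 hx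

theorem eLpNorm_le_of_lintegral_rpow_le {A : ℝ → ℝ≥0∞} {p : ℝ≥0∞} (hp : p ≠ 0) (hp' : p ≠ ∞)
    {C : ℝ≥0∞} (h : ∫⁻ x, A x ^ p.toReal ≤ C ^ p.toReal) {u : ℝ → ℂ}
    (hu : ∀ᵐ x, ‖u x‖ₑ ≤ A x) : eLpNorm u p volume ≤ C := by
  have h0 := ENNReal.toReal_pos hp hp'
  rw [eLpNorm_eq_lintegral_rpow_enorm_toReal hp hp']
  calc _ ≤ (C ^ p.toReal) ^ (1 / p.toReal) := by
        refine ENNReal.rpow_le_rpow (le_trans (lintegral_mono_ae ?_) h) (by positivity)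
        filter_upwards [hu] with x hx using ENNReal.rpow_le_rpow hx h0.le
    _ = C := by rw [← ENNReal.rpow_mul, mul_one_div_cancel h0.ne', ENNReal.rpow_one]

theorem posT_const_mul {F G : ℝ → ℝ≥0∞} (hF : Measurable F) (hG : Measurable G) (a b : ℝ≥0∞) :
    posT (fun u => a * F u) (fun u => b * G u) = fun x => a * b * posT F G x := by
  funext x
  rw [posT, posT, ← lintegral_const_mul _ (by fun_prop)]
  exact lintegral_congr fun t => by ring

theorem lintegral_posT_rpow_le {F G : ℝ → ℝ≥0∞} (hF : Measurable F) (hG : Measurable G)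
    (hF1 : ∫⁻ u, F u ^ (5 / 3 : ℝ) ≤ 1) (hG1 : ∫⁻ u, G u ^ (5 / 3 : ℝ) ≤ 1) :
    ∫⁻ x, posT F G x ^ (5 / 2 : ℝ) ≤ 3840 ^ (5 / 2 : ℝ) := by
  have hpq : (5 / 2 : ℝ).HolderConjugate (5 / 3) :=
    Real.holderConjugate_iff.2 ⟨by norm_num, by norm_num⟩
  exact lintegral_rpow_le_of_dual hpq (measurable_posT hF hG) (C := 3840) fun H hH hH1 =>
    lintegral_posT_mul_le hF hG hH hF1 hG1 hH1

theorem exists_normalized {p : ℝ≥0∞} (hp : p ≠ 0) (hp' : p ≠ ∞) {f : ℝ → ℂ} (hf : Measurable f)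
    (h : eLpNorm f p volume < ∞) :
    ∃ F : ℝ → ℝ≥0∞, Measurable F ∧ ∫⁻ u, F u ^ p.toReal ≤ 1 ∧
      ∀ᵐ u, ‖f u‖ₑ ≤ eLpNorm f p volume * F u := by
  have hr := ENNReal.toReal_pos hp hp'
  rcases eq_or_ne (eLpNorm f p volume) 0 with h0 | h0
  -- A function of norm 0 cannot be divided by its norm; this is why the domination is only claimed
  -- almost everywhere.
  · refine ⟨fun _ => 0, measurable_const, by simp [hr], ?_⟩
    filter_upwards [(eLpNorm_eq_zero_iff hf.aestronglyMeasurable hp).1 h0] with u hu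
    simp [hu]
  · refine ⟨fun u => (eLpNorm f p volume)⁻¹ * ‖f u‖ₑ, by fun_prop, ?_, .of_forall fun u => ?_⟩
    · simp only [ENNReal.mul_rpow_of_nonneg _ _ hr.le]
      rw [lintegral_const_mul _ (by fun_prop), ENNReal.inv_rpow,
        eLpNorm_eq_lintegral_rpow_enorm_toReal hp hp', ← ENNReal.rpow_mul,
        one_div_mul_cancel hr.ne', ENNReal.rpow_one]
      exact ENNReal.inv_mul_le_one _
    · rw [← mul_assoc, ENNReal.mul_inv_cancel h0 h.ne, one_mul]

theorem isStrongType_M : IsStrongType (5 / 3) (5 / 3) (5 / 2) := by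
  have hp0 : (5 / 3 : ℝ≥0∞) ≠ 0 := by simp
  have hpt : (5 / 3 : ℝ≥0∞) ≠ ∞ := ENNReal.div_ne_top (by simp) (by simp)
  have hr0 : (5 / 2 : ℝ≥0∞) ≠ 0 := by simp
  have hrt : (5 / 2 : ℝ≥0∞) ≠ ∞ := ENNReal.div_ne_top (by simp) (by simp)
  have hp : (5 / 3 : ℝ≥0∞).toReal = 5 / 3 := by simp
  have hr : (5 / 2 : ℝ≥0∞).toReal = 5 / 2 := by simp
  refine isBoundedBetween_of_posT (fun f g h => eLpNorm_congr_ae h)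
    (fun f g h => eLpNorm_congr_ae h) 3840 fun f g hf hg hNf hNg => ?_
  obtain ⟨F, hF, hF1, hfF⟩ := exists_normalized hp0 hpt hf hNf
  obtain ⟨G, hG, hG1, hgG⟩ := exists_normalized hp0 hpt hg hNg
  rw [hp] at hF1 hG1
  set a := eLpNorm f (5 / 3) volume
  set b := eLpNorm g (5 / 3) volume
  have key : ∫⁻ x, posT (fun u => ‖f u‖ₑ) (fun u => ‖g u‖ₑ) x ^ (5 / 2 : ℝ)
      ≤ (3840 * a * b) ^ (5 / 2 : ℝ) := by
    have hm := posT_mono_ae hfF hgG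
    rw [posT_const_mul hF hG] at hm
    calc _ ≤ ∫⁻ x, (a * b * posT F G x) ^ (5 / 2 : ℝ) := by
          refine lintegral_mono_ae ?_
          filter_upwards [hm] with x hx using ENNReal.rpow_le_rpow hx (by norm_num)
      _ = (a * b) ^ (5 / 2 : ℝ) * ∫⁻ x, posT F G x ^ (5 / 2 : ℝ) := by
          simp only [ENNReal.mul_rpow_of_nonneg _ _ (by norm_num : (0 : ℝ) ≤ 5 / 2)]
          exact lintegral_const_mul _ ((measurable_posT hF hG).pow_const _)
      _ ≤ (a * b) ^ (5 / 2 : ℝ) * 3840 ^ (5 / 2 : ℝ) := by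
          gcongr; exact lintegral_posT_rpow_le hF hG hF1 hG1
      _ = _ := by
          rw [← ENNReal.mul_rpow_of_nonneg _ _ (by norm_num)]; congr 1; ring
  refine ⟨ae_lt_top_of_lintegral_rpow (measurable_posT (by fun_prop) (by fun_prop))
    (by norm_num : (0 : ℝ) < 5 / 2) (ne_top_of_le_ne_top
      (ENNReal.rpow_ne_top_of_nonneg (by norm_num) (ENNReal.mul_lt_top (ENNReal.mul_lt_top
        (by simp) hNf) hNg).ne) key), fun u hu => ?_⟩
  rw [← hr] at key
  exact eLpNorm_le_of_lintegral_rpow_le hr0 hrt key hu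

/-! ### Layer cake and the restricted-type points -/

theorem lintegral_layer {f : ℝ → ℂ} (hf : Measurable f) {ν : Measure ℝ} [SFinite ν] {ψ : ℝ → ℝ}
    (hψ : Measurable ψ) {k : ℝ → ℝ≥0∞} (hk : Measurable k) :
    ∫⁻ t, ‖f (ψ t)‖ₑ * k t ∂ν
      = ∫⁻ s in Set.Ioi (0 : ℝ), ∫⁻ t in {t | s < ‖f (ψ t)‖}, k t ∂ν := by
  have hm (s : ℝ) : MeasurableSet {t | s < ‖f (ψ t)‖} :=
    measurableSet_lt measurable_const (by fun_prop)
  simp_rw [← lintegral_indicator (hm _)]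
  have hM : Measurable fun z : ℝ × ℝ => {z : ℝ × ℝ | z.1 < ‖f (ψ z.2)‖}.indicator
      (fun z => k z.2) z :=
    (hk.comp measurable_snd).indicator (measurableSet_lt (by fun_prop) (by fun_prop))
  have hM' : AEMeasurable (Function.uncurry fun s t => {t | s < ‖f (ψ t)‖}.indicator k t)
      ((volume.restrict (Set.Ioi (0 : ℝ))).prod ν) := hM.aemeasurable
  rw [lintegral_lintegral_swap hM']
  refine lintegral_congr fun t => ?_
  have : ∀ s : ℝ, {t | s < ‖f (ψ t)‖}.indicator k t
      = (Set.Iio ‖f (ψ t)‖).indicator (fun _ => k t) s := fun s => by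
    simp only [Set.indicator, Set.mem_Iio, Set.mem_ofPred_eq]
  simp_rw [this]
  rw [lintegral_indicator measurableSet_Iio, setLIntegral_const,
    Measure.restrict_apply measurableSet_Iio, Set.Iio_inter_Ioi, Real.volume_Ioo, sub_zero,
    ofReal_norm, mul_comm]

theorem measurableSet_superlevel {f : ℝ → ℂ} (hf : Measurable f) (s : ℝ) :
    MeasurableSet {u | s < ‖f u‖} :=
  measurableSet_lt measurable_const (by fun_prop)

/-- The square-root bound for level sets, summed over heights, yields exactly the `L^{2,1}`
integral. -/
theorem lintegral_phase_le_distrib {f : ℝ → ℂ} (hf : Measurable f) {l : ℝ} (hl : 1 ≤ l) (θ y : ℝ) :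
    ∫⁻ t, ‖f (y + phase l θ t)‖ₑ ∂circ
      ≤ 1156 * ∫⁻ s in Set.Ioi (0 : ℝ), distrib f s ^ (1 / 2 : ℝ) := by
  have := lintegral_layer hf (ν := circ) (ψ := fun t => y + phase l θ t) (by fun_prop)
    (k := fun _ => 1) measurable_const
  simp only [mul_one] at this
  rw [this, ← lintegral_const_mul' _ _ (by simp)]
  refine lintegral_mono fun s => ?_
  rw [setLIntegral_one]
  exact circ_phase_mem_le (measurableSet_superlevel hf s) hl θ y

theorem lorentzOneNorm_of_ne_top {p : ℝ≥0∞} (hp : p ≠ ∞) (f : ℝ → ℂ) :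
    lorentzOneNorm p f = p * ∫⁻ s in Set.Ioi (0 : ℝ), distrib f s ^ (1 / p.toReal) :=
  if_neg hp

theorem lintegral_distrib_le_lorentzOneNorm {p : ℝ≥0∞} (hp : 1 ≤ p) (hp' : p ≠ ∞) (f : ℝ → ℂ) :
    ∫⁻ s in Set.Ioi (0 : ℝ), distrib f s ^ (1 / p.toReal) ≤ lorentzOneNorm p f := by
  rw [lorentzOneNorm_of_ne_top hp']
  exact le_mul_of_one_le_left zero_le hp

theorem lorentzOneNorm_one {f : ℝ → ℂ} (hf : Measurable f) :
    lorentzOneNorm 1 f = ∫⁻ u, ‖f u‖ₑ := by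
  have := lintegral_layer hf (ν := volume) (ψ := fun t => t) (by fun_prop)
    (k := fun _ => 1) measurable_const
  simp only [mul_one, setLIntegral_one] at this
  rw [this, lorentzOneNorm_of_ne_top (by simp)]
  simp [distrib]

theorem lintegral_phase_le_lorentzOneNorm {f : ℝ → ℂ} (hf : Measurable f) {l : ℝ} (hl : 1 ≤ l)
    (θ y : ℝ) : ∫⁻ t, ‖f (y + phase l θ t)‖ₑ ∂circ ≤ 1156 * lorentzOneNorm 2 f := by
  refine (lintegral_phase_le_distrib hf hl θ y).trans (mul_le_mul' le_rfl ?_)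
  simpa using lintegral_distrib_le_lorentzOneNorm (p := 2) (by norm_num) (by simp) f

theorem isRestrictedType_P : IsRestrictedType 2 1 1 := by
  refine isBoundedBetween_of_posT (fun f g h => lorentzOneNorm_congr h)
    (fun f g h => lorentzOneNorm_congr h) 1156 fun f g hf hg hNf hNg => ?_
  have key : ∫⁻ x, posT (fun u => ‖f u‖ₑ) (fun u => ‖g u‖ₑ) x
      ≤ 1156 * lorentzOneNorm 2 f * lorentzOneNorm 1 g := by
    rw [lorentzOneNorm_one hg]
    have := lintegral_posT_mul_le_of_forall (F := fun u => ‖f u‖ₑ) (G := fun u => ‖g u‖ₑ)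
      (H := fun _ => 1) (by fun_prop) (by fun_prop) measurable_const
      (M := 1156 * lorentzOneNorm 2 f) fun y => by
        simpa only [phase_sqrt_two_five_pi_div_four, mul_one] using
          lintegral_phase_le_lorentzOneNorm hf one_le_sqrt_two (Real.pi / 4 + Real.pi) y
    simpa only [mul_one] using this
  refine ⟨?_, fun u hu => ?_⟩
  · exact ae_lt_top (measurable_posT (by fun_prop) (by fun_prop)) (ne_top_of_le_ne_top
      (ENNReal.mul_lt_top (ENNReal.mul_lt_top (by simp) hNf) hNg).ne key)
  · simp only [eLpNorm_one_eq_lintegral_enorm (f := u)]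
    exact (lintegral_mono_ae hu).trans key

theorem lorentzOneNorm_top (f : ℝ → ℂ) : lorentzOneNorm ∞ f = eLpNorm f ∞ volume := if_pos rfl

theorem isRestrictedType_E : IsRestrictedType ∞ 2 ∞ := by
  refine isBoundedBetween_of_posT (fun f g h => lorentzOneNorm_congr h)
    (fun f g h => lorentzOneNorm_congr h) 1156 fun f g hf hg hNf hNg => ?_
  have key : ∀ᵐ x, posT (fun u => ‖f u‖ₑ) (fun u => ‖g u‖ₑ) x
      ≤ 1156 * lorentzOneNorm ∞ f * lorentzOneNorm 2 g := by
    filter_upwards [posT_mono_ae (ae_enorm_le_eLpNorm_top f) (.of_forall fun _ => le_rfl)] with x hx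
    refine hx.trans ?_
    rw [posT_const_left _ (by fun_prop), lorentzOneNorm_top, mul_comm 1156, mul_assoc]
    refine mul_le_mul' le_rfl ?_
    simpa only [phase_one_pi_div_two, ← sub_eq_add_neg] using
      lintegral_phase_le_lorentzOneNorm hg le_rfl (Real.pi / 2) x
  refine ⟨?_, fun u hu => ?_⟩
  · filter_upwards [key] with x hx
    exact hx.trans_lt (ENNReal.mul_lt_top (ENNReal.mul_lt_top (by simp) hNf) hNg)
  · simp only [eLpNorm_exponent_top (f := u)]
    refine eLpNormEssSup_le_of_ae_enorm_bound ?_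
    filter_upwards [key, hu] with x h1 h2 using h2.trans h1

theorem le_rpow_third_mul {X a b c d : ℝ≥0∞} (ha : 1 ≤ a) (hc : 1 ≤ c) (h1 : X ≤ a * b)
    (h2 : X ≤ c * d ^ (1 / 2 : ℝ)) : X ≤ a * c * (b ^ (1 / 3 : ℝ) * d ^ (1 / 3 : ℝ)) := by
  calc X = X ^ (1 / 3 : ℝ) * X ^ (2 / 3 : ℝ) := by
        rw [← ENNReal.rpow_add_of_nonneg _ _ (by norm_num) (by norm_num)]; norm_num
    _ ≤ (a * b) ^ (1 / 3 : ℝ) * (c * d ^ (1 / 2 : ℝ)) ^ (2 / 3 : ℝ) := by gcongr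
    _ = a ^ (1 / 3 : ℝ) * c ^ (2 / 3 : ℝ) * (b ^ (1 / 3 : ℝ) * d ^ (1 / 3 : ℝ)) := by
        rw [ENNReal.mul_rpow_of_nonneg _ _ (by norm_num), ENNReal.mul_rpow_of_nonneg _ _ (by norm_num),
          ← ENNReal.rpow_mul, show (1 / 2 * (2 / 3) : ℝ) = 1 / 3 by norm_num]
        ring
    _ ≤ _ := by
        gcongr <;> exact rpow_le_self_of_one_le (by assumption) (by norm_num)

/-- Wherever `|sin t| ≥ 1/4`, the condition on `D` has measure `O(|D|)` and that on `E` has measure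
`O(|E|^{1/2})`; the geometric mean with weights 1/3 and 2/3 gives `|D|^{1/3}|E|^{1/3}`. Where `|cos
t| ≥ 1/4` the roles are exchanged, and one of the two always holds. -/
theorem circ_sub_cos_mem_sub_sin_mem_le {D E : Set ℝ} (hD : MeasurableSet D) (hE : MeasurableSet E)
    (x : ℝ) :
    circ ({t | x - Real.cos t ∈ D} ∩ {t | x - Real.sin t ∈ E})
      ≤ 36992 * (volume D ^ (1 / 3 : ℝ) * volume E ^ (1 / 3 : ℝ)) := by
  set S := {t | x - Real.cos t ∈ D} with hS
  set R := {t | x - Real.sin t ∈ E} with hR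
  set Vs : Set ℝ := {t | 1 / 4 ≤ |Real.sin t|} with hVs
  set Vc : Set ℝ := {t | 1 / 4 ≤ |Real.cos t|} with hVc
  have ms : MeasurableSet Vs := measurableSet_le measurable_const (by fun_prop)
  have mc : MeasurableSet Vc := measurableSet_le measurable_const (by fun_prop)
  have mS : MeasurableSet S := (by fun_prop : Measurable fun t => x - Real.cos t) hD
  have mR : MeasurableSet R := (by fun_prop : Measurable fun t => x - Real.sin t) hE
  have hS1 : circ S ≤ 1156 * volume D ^ (1 / 2 : ℝ) := by
    simpa only [phase_one_pi, ← sub_eq_add_neg] using circ_phase_mem_le hD le_rfl Real.pi x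
  have hR1 : circ R ≤ 1156 * volume E ^ (1 / 2 : ℝ) := by
    simpa only [phase_one_pi_div_two, ← sub_eq_add_neg] using
      circ_phase_mem_le hE le_rfl (Real.pi / 2) x
  have hS2 : circ (S ∩ Vs) ≤ 16 * volume D := by
    have := setLIntegral_sub_cos_le (D.indicator 1) x ms fun t ht => ht
    rw [lintegral_indicator_one hD] at this
    refine le_trans (le_of_eq ?_) this
    rw [← Measure.restrict_apply mS, ← lintegral_indicator_one mS]
    rfl
  have hR2 : circ (R ∩ Vc) ≤ 16 * volume E := by
    have := setLIntegral_sub_sin_le (E.indicator 1) x mc fun t ht => ht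
    rw [lintegral_indicator_one hE] at this
    refine le_trans (le_of_eq ?_) this
    rw [← Measure.restrict_apply mR, ← lintegral_indicator_one mR]
    rfl
  have h1 : circ (S ∩ R ∩ Vs) ≤ 16 * 1156 * (volume D ^ (1 / 3 : ℝ) * volume E ^ (1 / 3 : ℝ)) :=
    le_rpow_third_mul (by norm_num) (by norm_num)
      ((measure_mono (Set.inter_subset_inter_left _ Set.inter_subset_left)).trans hS2)
      ((measure_mono (Set.inter_subset_left.trans Set.inter_subset_right)).trans hR1)
  have h2 : circ (S ∩ R ∩ Vc) ≤ 16 * 1156 * (volume D ^ (1 / 3 : ℝ) * volume E ^ (1 / 3 : ℝ)) := by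
    rw [mul_comm (volume D ^ _)]
    exact le_rpow_third_mul (by norm_num) (by norm_num)
      ((measure_mono (Set.inter_subset_inter_left _ Set.inter_subset_right)).trans hR2)
      ((measure_mono (Set.inter_subset_left.trans Set.inter_subset_left)).trans hS1)
  calc circ (S ∩ R) ≤ circ (S ∩ R ∩ Vs ∪ S ∩ R ∩ Vc) := by
        refine measure_mono fun t ht => ?_
        rcases jacobian_cases t with h | h | h
        · exact Or.inr ⟨ht, h.1⟩
        · exact Or.inl ⟨ht, h.1⟩
        · exact Or.inl ⟨ht, h.1⟩
    _ ≤ _ := measure_union_le _ _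
    _ ≤ _ := add_le_add h1 h2
    _ = _ := by ring

theorem isRestrictedType_B : IsRestrictedType 3 3 ∞ := by
  refine isBoundedBetween_of_posT (fun f g h => lorentzOneNorm_congr h)
    (fun f g h => lorentzOneNorm_congr h) 36992 fun f g hf hg hNf hNg => ?_
  have key (x : ℝ) : posT (fun u => ‖f u‖ₑ) (fun u => ‖g u‖ₑ) x
      ≤ 36992 * lorentzOneNorm 3 f * lorentzOneNorm 3 g := by
    have m1 (s : ℝ) : MeasurableSet {t | s < ‖f (x - Real.cos t)‖} :=
      measurableSet_lt measurable_const (by fun_prop)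
    rw [posT, lintegral_layer hf (by fun_prop) (by fun_prop)]
    have inner (s : ℝ) : ∫⁻ t in {t | s < ‖f (x - Real.cos t)‖}, ‖g (x - Real.sin t)‖ₑ ∂circ
        ≤ distrib f s ^ (1 / 3 : ℝ) * (36992 * lorentzOneNorm 3 g) := by
      have := lintegral_layer hg (ν := circ.restrict {t | s < ‖f (x - Real.cos t)‖})
        (ψ := fun t => x - Real.sin t) (by fun_prop) (k := fun _ => 1) measurable_const
      simp only [mul_one, setLIntegral_one] at this
      rw [this]
      calc _ ≤ ∫⁻ r in Set.Ioi (0 : ℝ),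
            36992 * distrib f s ^ (1 / 3 : ℝ) * distrib g r ^ (1 / 3 : ℝ) := by
            refine lintegral_mono fun r => ?_
            rw [Measure.restrict_apply (measurableSet_lt measurable_const (by fun_prop)),
              Set.inter_comm, mul_assoc]
            exact circ_sub_cos_mem_sub_sin_mem_le (measurableSet_superlevel hf s)
              (measurableSet_superlevel hg r) x
        _ = 36992 * distrib f s ^ (1 / 3 : ℝ)
            * ∫⁻ r in Set.Ioi (0 : ℝ), distrib g r ^ (1 / 3 : ℝ) := by
            refine lintegral_const_mul _ ?_
            have : Antitone (distrib g) := fun a b hab =>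
              measure_mono fun u (hu : b < ‖g u‖) => hab.trans_lt hu
            exact this.measurable.pow_const _
        _ ≤ 36992 * distrib f s ^ (1 / 3 : ℝ) * lorentzOneNorm 3 g := by
            refine mul_le_mul' le_rfl ?_
            simpa using lintegral_distrib_le_lorentzOneNorm (p := 3) (by norm_num) (by simp) g
        _ = _ := by ring
    calc _ ≤ ∫⁻ s in Set.Ioi (0 : ℝ), distrib f s ^ (1 / 3 : ℝ) * (36992 * lorentzOneNorm 3 g) :=
          lintegral_mono inner
      _ = (∫⁻ s in Set.Ioi (0 : ℝ), distrib f s ^ (1 / 3 : ℝ)) * (36992 * lorentzOneNorm 3 g) :=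
          lintegral_mul_const' _ _ (ENNReal.mul_ne_top (by simp) hNg.ne)
      _ ≤ lorentzOneNorm 3 f * (36992 * lorentzOneNorm 3 g) := by
          refine mul_le_mul' ?_ le_rfl
          simpa using lintegral_distrib_le_lorentzOneNorm (p := 3) (by norm_num) (by simp) f
      _ = _ := by ring
  refine ⟨.of_forall fun x => (key x).trans_lt
    (ENNReal.mul_lt_top (ENNReal.mul_lt_top (by simp) hNf) hNg), fun u hu => ?_⟩
  simp only [eLpNorm_exponent_top (f := u)]
  refine eLpNormEssSup_le_of_ae_enorm_bound ?_
  filter_upwards [hu] with x h2 using h2.trans (key x)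

/-- Where the phase of `H` is good, Hölder leaves `|S|^{2/3}` and `|S| = O(|E|^{1/2})`. Where the
phase of `E` is good, `|S| = O(|E|)` and the single-phase `L³` bound leaves `|S|^{1/3}`. Both give
`|E|^{1/3}`. -/
theorem setLIntegral_mem_mul_le {E : Set ℝ} (hE : MeasurableSet E) {H : ℝ → ℝ≥0∞}
    (hH : Measurable H) (y : ℝ) :
    ∫⁻ t in {t | y + (Real.sin t - Real.cos t) ∈ E}, H (y + Real.sin t) ∂circ
      ≤ 19040 * (∫⁻ u, H u ^ (3 : ℝ)) ^ (1 / 3 : ℝ) * volume E ^ (1 / 3 : ℝ) := by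
  set S := {t | y + (Real.sin t - Real.cos t) ∈ E} with hS
  set Vd : Set ℝ := {t | 1 / 4 ≤ |Real.sin t + Real.cos t|} with hVd
  set Vc : Set ℝ := {t | 1 / 4 ≤ |Real.cos t|} with hVc
  have md : MeasurableSet Vd := measurableSet_le measurable_const (by fun_prop)
  have mc : MeasurableSet Vc := measurableSet_le measurable_const (by fun_prop)
  have mS : MeasurableSet S :=
    (by fun_prop : Measurable fun t => y + (Real.sin t - Real.cos t)) hE
  set I := ∫⁻ u, H u ^ (3 : ℝ) with hI
  have hS1 : circ S ≤ 1156 * volume E ^ (1 / 2 : ℝ) := by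
    simpa only [phase_sqrt_two_five_pi_div_four] using
      circ_phase_mem_le hE one_le_sqrt_two (Real.pi / 4 + Real.pi) y
  have hS2 : circ (S ∩ Vd) ≤ 16 * volume E := by
    have := setLIntegral_sin_sub_cos_le (E.indicator 1) y md fun t ht => ht
    rw [lintegral_indicator_one hE] at this
    refine le_trans (le_of_eq ?_) this
    rw [← Measure.restrict_apply mS, ← lintegral_indicator_one mS]
    rfl
  have h1 : ∫⁻ t in S ∩ Vc, H (y + Real.sin t) ∂circ
      ≤ 18496 * I ^ (1 / 3 : ℝ) * volume E ^ (1 / 3 : ℝ) := by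
    calc _ = ∫⁻ t in S ∩ Vc, (H (y + Real.sin t) ^ (3 : ℝ)) ^ (1 / 3 : ℝ) * 1 ^ (2 / 3 : ℝ) ∂circ := by
          refine lintegral_congr fun t => ?_
          rw [← ENNReal.rpow_mul]; norm_num
      _ ≤ (∫⁻ t in S ∩ Vc, H (y + Real.sin t) ^ (3 : ℝ) ∂circ) ^ (1 / 3 : ℝ)
          * (∫⁻ t in S ∩ Vc, 1 ∂circ) ^ (2 / 3 : ℝ) :=
          ENNReal.lintegral_mul_norm_pow_le (by fun_prop) (by fun_prop) (by norm_num)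
            (by norm_num) (by norm_num)
      _ ≤ (16 * I) ^ (1 / 3 : ℝ) * (1156 * volume E ^ (1 / 2 : ℝ)) ^ (2 / 3 : ℝ) := by
          gcongr
          · exact (lintegral_mono_set Set.inter_subset_right).trans
              (setLIntegral_sin_le (fun u => H u ^ (3 : ℝ)) y mc fun t ht => ht)
          · rw [setLIntegral_one]
            exact (measure_mono Set.inter_subset_left).trans hS1
      _ = 16 ^ (1 / 3 : ℝ) * 1156 ^ (2 / 3 : ℝ) * I ^ (1 / 3 : ℝ) * volume E ^ (1 / 3 : ℝ) := by
          rw [ENNReal.mul_rpow_of_nonneg _ _ (by norm_num),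
            ENNReal.mul_rpow_of_nonneg _ _ (by norm_num), ← ENNReal.rpow_mul,
            show (1 / 2 * (2 / 3) : ℝ) = 1 / 3 by norm_num]
          ring
      _ ≤ 16 * 1156 * I ^ (1 / 3 : ℝ) * volume E ^ (1 / 3 : ℝ) := by
          gcongr <;> exact rpow_le_self_of_one_le (by norm_num) (by norm_num)
      _ = _ := by norm_num
  have h2 : ∫⁻ t in S ∩ Vd, H (y + Real.sin t) ∂circ
      ≤ 544 * I ^ (1 / 3 : ℝ) * volume E ^ (1 / 3 : ℝ) := by
    have := setLIntegral_phase_le hH (S ∩ Vd) le_rfl (-(Real.pi / 2)) y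
    simp only [phase_one_neg_pi_div_two] at this
    calc _ ≤ 34 * I ^ (1 / 3 : ℝ) * (16 * volume E) ^ (1 / 3 : ℝ) :=
          this.trans (by gcongr)
      _ = 34 * I ^ (1 / 3 : ℝ) * (16 ^ (1 / 3 : ℝ) * volume E ^ (1 / 3 : ℝ)) := by
          rw [ENNReal.mul_rpow_of_nonneg _ _ (by norm_num)]
      _ ≤ 34 * I ^ (1 / 3 : ℝ) * (16 * volume E ^ (1 / 3 : ℝ)) := by
          gcongr; exact rpow_le_self_of_one_le (by norm_num) (by norm_num)
      _ = _ := by ring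
  calc _ ≤ ∫⁻ t in (S ∩ Vc) ∪ (S ∩ Vd), H (y + Real.sin t) ∂circ := by
        refine lintegral_mono_set fun t ht => ?_
        rcases jacobian_cases t with h | h | h
        · exact Or.inr ⟨ht, h.2⟩
        · exact Or.inr ⟨ht, h.2⟩
        · exact Or.inl ⟨ht, h.2⟩
    _ ≤ _ := lintegral_union_le _ _ _
    _ ≤ _ := add_le_add h1 h2
    _ = _ := by ring

theorem isRestrictedType_G : IsRestrictedType 3 1 (3 / 2) := by
  have hr0 : (3 / 2 : ℝ≥0∞) ≠ 0 := by simp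
  have hrt : (3 / 2 : ℝ≥0∞) ≠ ∞ := ENNReal.div_ne_top (by simp) (by simp)
  have hr : (3 / 2 : ℝ≥0∞).toReal = 3 / 2 := by simp
  refine isBoundedBetween_of_posT (fun f g h => lorentzOneNorm_congr h)
    (fun f g h => lorentzOneNorm_congr h) 19040 fun f g hf hg hNf hNg => ?_
  have hCt : 19040 * lorentzOneNorm 3 f * lorentzOneNorm 1 g < ∞ :=
    ENNReal.mul_lt_top (ENNReal.mul_lt_top (by simp) hNf) hNg
  have key : ∫⁻ x, posT (fun u => ‖f u‖ₑ) (fun u => ‖g u‖ₑ) x ^ (3 / 2 : ℝ)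
      ≤ (19040 * lorentzOneNorm 3 f * lorentzOneNorm 1 g) ^ (3 / 2 : ℝ) := by
    have hpq : (3 / 2 : ℝ).HolderConjugate 3 :=
      Real.holderConjugate_iff.2 ⟨by norm_num, by norm_num⟩
    rw [← ENNReal.coe_toNNReal hCt.ne]
    -- Duality with the unit ball of `L³`; since `g` is in `L¹`, it remains to bound the form
    -- centred at `g` uniformly, which the layer cake in `f` does.
    refine lintegral_rpow_le_of_dual hpq (measurable_posT (by fun_prop) (by fun_prop))
      fun H hH hH1 => ?_
    rw [ENNReal.coe_toNNReal hCt.ne, lorentzOneNorm_one hg]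
    refine lintegral_posT_mul_le_of_forall (by fun_prop) (by fun_prop) hH fun y => ?_
    rw [lintegral_layer hf (by fun_prop) (by fun_prop)]
    calc _ ≤ ∫⁻ s in Set.Ioi (0 : ℝ), 19040 * distrib f s ^ (1 / 3 : ℝ) := by
          refine lintegral_mono fun s => ?_
          refine (setLIntegral_mem_mul_le (measurableSet_superlevel hf s) hH y).trans ?_
          refine mul_le_mul' (mul_le_of_le_one_right zero_le ?_) le_rfl
          exact ENNReal.rpow_le_one hH1 (by norm_num)
      _ = 19040 * ∫⁻ s in Set.Ioi (0 : ℝ), distrib f s ^ (1 / 3 : ℝ) :=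
          lintegral_const_mul' _ _ (by simp)
      _ ≤ _ := by
          refine mul_le_mul' le_rfl ?_
          simpa using lintegral_distrib_le_lorentzOneNorm (p := 3) (by norm_num) (by simp) f
  refine ⟨ae_lt_top_of_lintegral_rpow (measurable_posT (by fun_prop) (by fun_prop))
    (by norm_num : (0 : ℝ) < 3 / 2) (ne_top_of_le_ne_top
      (ENNReal.rpow_ne_top_of_nonneg (by norm_num) hCt.ne) key), fun u hu => ?_⟩
  rw [← hr] at key
  rw [← ENNReal.coe_toNNReal hCt.ne] at key
  exact (eLpNorm_le_of_lintegral_rpow_le hr0 hrt key hu).trans_eq (ENNReal.coe_toNNReal hCt.ne)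

/-! ### Weak type at K -/

theorem mul_rpow_half_le {s V M : ℝ≥0∞} (hV : V ≠ ∞) (h : s * V ≤ M * V ^ (1 / 2 : ℝ)) :
    s * V ^ (1 / 2 : ℝ) ≤ M := by
  rcases eq_or_ne V 0 with h0 | h0
  · simp [h0]
  have hp : V ^ (1 / 2 : ℝ) ≠ 0 := by
    rw [Ne, ENNReal.rpow_eq_zero_iff]
    simp [h0, hV]
  have hp' : V ^ (1 / 2 : ℝ) ≠ ∞ := ENNReal.rpow_ne_top_of_nonneg (by norm_num) hV
  refine (ENNReal.mul_le_mul_iff_left hp hp').1 ?_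
  rw [mul_assoc, ← ENNReal.rpow_add _ _ h0 hV]
  norm_num at h ⊢
  exact h

theorem isWeakType_K : IsWeakType ∞ 1 2 := by
  refine isBoundedBetween_of_posT (fun f g h => eLpNorm_congr_ae h)
    (fun f g h => eLpNorm_congr_ae h) 1156 fun f g hf hg hNf hNg => ?_
  set a := eLpNorm f ∞ volume with ha
  set A := posT (fun _ => a) (fun u => ‖g u‖ₑ) with hA
  have hAm : Measurable A := measurable_posT measurable_const (by fun_prop)
  have hle : ∀ᵐ x, posT (fun u => ‖f u‖ₑ) (fun u => ‖g u‖ₑ) x ≤ A x :=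
    posT_mono_ae (ae_enorm_le_eLpNorm_top f) (.of_forall fun _ => le_rfl)
  have hA1 : ∫⁻ x, A x < ∞ := by
    refine (lintegral_posT_const_le a (by fun_prop)).trans_lt ?_
    rw [← eLpNorm_one_eq_lintegral_enorm]
    exact ENNReal.mul_lt_top (ENNReal.mul_lt_top hNf (by simp)) hNg
  refine ⟨?_, fun u hu => ?_⟩
  · filter_upwards [ae_lt_top hAm hA1.ne, hle] with x h1 h2 using h2.trans_lt h1
  rw [weakNorm, if_neg (by simp)]
  refine iSup_le fun ⟨s, hs⟩ => ?_
  have hs' : (0 : ℝ) < s := hs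
  set E : Set ℝ := {x | ENNReal.ofReal s ≤ A x} with hE
  have hEm : MeasurableSet E := measurableSet_le measurable_const hAm
  have hcheb : ENNReal.ofReal s * volume E ≤ ∫⁻ x in E, A x := by
    rw [← setLIntegral_const]
    exact setLIntegral_mono' hEm fun x hx => hx
  -- The strong bound at C makes the superlevel set finite, as needed to cancel `|E|^{1/2}` from
  -- `s|E| ≤ M|E|^{1/2}`.
  have hEt : volume E ≠ ∞ := by
    intro h
    have h3 := hcheb.trans (setLIntegral_le_lintegral _ _)
    rw [h, ENNReal.mul_top (by simpa using hs')] at h3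
    exact absurd (h3.trans_lt hA1) (by simp)
  have hE2 : ∫⁻ x in E, A x ≤ 1156 * a * eLpNorm g 1 volume * volume E ^ (1 / 2 : ℝ) := by
    have := lintegral_posT_mul_le_of_forall (F := fun _ => a) (G := fun u => ‖g u‖ₑ)
      (H := E.indicator 1) measurable_const (by fun_prop) (measurable_one.indicator hEm)
      (M := a * (1156 * volume E ^ (1 / 2 : ℝ))) fun y => by
        have hEm' : Measurable (E.indicator (1 : ℝ → ℝ≥0∞)) := measurable_one.indicator hEm
        rw [lintegral_const_mul _ (by fun_prop)]
        refine mul_le_mul' le_rfl ?_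
        have h4 := circ_phase_mem_le hEm le_rfl (-(Real.pi / 2)) y
        simp only [phase_one_neg_pi_div_two] at h4
        have hmy : MeasurableSet {t | y + Real.sin t ∈ E} :=
          (by fun_prop : Measurable fun t => y + Real.sin t) hEm
        rw [← lintegral_indicator_one hmy] at h4
        exact h4
    rw [← lintegral_indicator hEm, eLpNorm_one_eq_lintegral_enorm]
    calc _ = ∫⁻ x, A x * E.indicator 1 x := by
          refine lintegral_congr fun x => ?_
          by_cases hx : x ∈ E <;> simp [hx]
      _ ≤ _ := this
      _ = _ := by ring
  have hdu : distrib u s ≤ volume E := by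
    refine measure_mono_ae ?_
    filter_upwards [hu, hle] with x h1 h2 h3
    have h3' : s < ‖u x‖ := h3
    change ENNReal.ofReal s ≤ A x
    refine le_trans ?_ (h1.trans h2)
    rw [← ofReal_norm]
    exact ENNReal.ofReal_le_ofReal h3'.le
  calc ENNReal.ofReal s * distrib u s ^ (1 / (2 : ℝ≥0∞).toReal)
      ≤ ENNReal.ofReal s * volume E ^ (1 / 2 : ℝ) := by
        rw [ENNReal.toReal_ofNat]; gcongr
    _ ≤ _ := mul_rpow_half_le hEt (hcheb.trans hE2)
    _ = _ := rfl

/-! ### Test functions with logarithmic growth -/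

/-- A continuous cutoff function, equal to `1` on `[-7, 7]` and supported in `[-8, 8]`. -/
noncomputable def cutoff (u : ℝ) : ℝ := max 0 (min 1 (8 - |u|))

/-- The truncated power `max (δ, |u - c|) ^ (-a)`, cut off at large `u`. -/
noncomputable def peak (a c δ u : ℝ) : ℝ := max δ |u - c| ^ (-a) * cutoff u

/-- The tent function of height and half-width `δ`. -/
noncomputable def tent (δ u : ℝ) : ℝ := max 0 (δ - |u|)

theorem cutoff_nonneg (u : ℝ) : 0 ≤ cutoff u := le_max_left _ _

theorem cutoff_le_one (u : ℝ) : cutoff u ≤ 1 := max_le zero_le_one (min_le_left _ _)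

theorem cutoff_eq_one {u : ℝ} (h : |u| ≤ 7) : cutoff u = 1 := by
  rw [cutoff, min_eq_left (by linarith), max_eq_right zero_le_one]

theorem cutoff_eq_zero {u : ℝ} (h : u ∉ Set.Icc (-8 : ℝ) 8) : cutoff u = 0 := by
  have : 8 < |u| := by
    by_contra hc
    exact h (abs_le.1 (not_lt.1 hc))
  rw [cutoff, min_eq_right (by linarith), max_eq_left (by linarith)]

theorem continuous_cutoff : Continuous cutoff := by unfold cutoff; fun_prop

theorem peak_nonneg {a c δ : ℝ} (hδ : 0 < δ) (u : ℝ) : 0 ≤ peak a c δ u :=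
  mul_nonneg (Real.rpow_nonneg (hδ.le.trans (le_max_left _ _)) _) (cutoff_nonneg u)

theorem continuous_peak {a c δ : ℝ} (hδ : 0 < δ) : Continuous (peak a c δ) := by
  refine Continuous.mul ?_ continuous_cutoff
  exact Continuous.rpow_const (by fun_prop)
    fun u => Or.inl (hδ.trans_le (le_max_left _ _)).ne'

theorem hasCompactSupport_peak (a c δ : ℝ) : HasCompactSupport fun u => (peak a c δ u : ℂ) :=
  HasCompactSupport.intro isCompact_Icc fun u hu => by
    rw [peak, cutoff_eq_zero hu, mul_zero, Complex.ofReal_zero]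

theorem integral_inv_max_abs {δ : ℝ} (hδ : 0 < δ) (hδ1 : δ ≤ 1) :
    ∫ v in (-10 : ℝ)..10, (max δ |v|)⁻¹ = 2 * (1 + Real.log (10 / δ)) := by
  have hc : Continuous fun v : ℝ => (max δ |v|)⁻¹ :=
    Continuous.inv₀ (by fun_prop) fun v => (hδ.trans_le (le_max_left _ _)).ne'
  have hi (a b : ℝ) : IntervalIntegrable (fun v : ℝ => (max δ |v|)⁻¹) volume a b :=
    hc.intervalIntegrable a b
  have half : ∫ v in (0 : ℝ)..10, (max δ |v|)⁻¹ = 1 + Real.log (10 / δ) := by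
    rw [← intervalIntegral.integral_add_adjacent_intervals (hi 0 δ) (hi δ 10)]
    congr 1
    · rw [intervalIntegral.integral_congr (g := fun _ => δ⁻¹)]
      · simp [hδ.ne']
      · intro v hv
        rw [Set.uIcc_of_le hδ.le] at hv
        simp only
        rw [abs_of_nonneg hv.1, max_eq_left hv.2]
    · rw [← integral_inv_of_pos hδ (by norm_num)]
      refine intervalIntegral.integral_congr fun v hv => ?_
      rw [Set.uIcc_of_le (by linarith)] at hv
      rw [abs_of_nonneg (hδ.le.trans hv.1), max_eq_right hv.1]
  have neg : ∫ v in (-10 : ℝ)..0, (max δ |v|)⁻¹ = ∫ v in (0 : ℝ)..10, (max δ |v|)⁻¹ := by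
    have := intervalIntegral.integral_comp_neg (a := 0) (b := 10) fun v : ℝ => (max δ |v|)⁻¹
    simp only [abs_neg, neg_zero] at this
    exact this.symm
  rw [← intervalIntegral.integral_add_adjacent_intervals (hi (-10) 0) (hi 0 10), neg, half]
  ring

theorem lintegral_inv_max_abs_le {c m : ℝ} (hc : |c| ≤ 2) (hm : 1 ≤ m) :
    ∫⁻ u in Set.Icc (-8 : ℝ) 8, ENNReal.ofReal (max (Real.exp (-m)) |u - c|)⁻¹
      ≤ ENNReal.ofReal (22 * m) := by
  set δ := Real.exp (-m) with hδdef
  have hδ : 0 < δ := Real.exp_pos _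
  have hδ1 : δ ≤ 1 := Real.exp_le_one_iff.2 (by linarith)
  have hcont : Continuous fun v : ℝ => (max δ |v|)⁻¹ :=
    Continuous.inv₀ (by fun_prop) fun v => (hδ.trans_le (le_max_left _ _)).ne'
  have hnn (v : ℝ) : 0 ≤ (max δ |v|)⁻¹ := inv_nonneg.2 (hδ.le.trans (le_max_left _ _))
  have hcont' : Continuous fun u : ℝ => (max δ |u - c|)⁻¹ :=
    hcont.comp (continuous_id.sub continuous_const)
  obtain ⟨hc1, hc2⟩ := abs_le.1 hc
  rw [← ofReal_integral_eq_lintegral_ofReal (hcont'.integrableOn_Icc)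
    (.of_forall fun u => hnn _), integral_Icc_eq_integral_Ioc,
    ← intervalIntegral.integral_of_le (by norm_num),
    intervalIntegral.integral_comp_sub_right (fun v => (max δ |v|)⁻¹)]
  refine ENNReal.ofReal_le_ofReal ?_
  calc _ ≤ ∫ v in (-10 : ℝ)..10, (max δ |v|)⁻¹ :=
        intervalIntegral.integral_mono_interval (by linarith) (by linarith) (by linarith)
          (.of_forall hnn) (hcont.intervalIntegrable _ _)
    _ = 2 * (1 + Real.log (10 / δ)) := integral_inv_max_abs hδ hδ1
    _ ≤ 22 * m := by
        rw [Real.log_div (by norm_num) hδ.ne', hδdef, Real.log_exp]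
        have := Real.log_le_sub_one_of_pos (by norm_num : (0 : ℝ) < 10)
        linarith

/-- The exponent `1/p` is critical: the `p`-th power of the peak is at most a truncated `|u -
c|^{-1}`, whose integral is of order `m`. For `p = ∞`, `p.toReal⁻¹` is 0 by convention, and the peak
reduces to the cutoff. -/
theorem eLpNorm_peak_le {p : ℝ≥0∞} (hp : p ≠ 0) {c m : ℝ} (hc : |c| ≤ 2) (hm : 1 ≤ m) :
    eLpNorm (fun u => (peak p.toReal⁻¹ c (Real.exp (-m)) u : ℂ)) p volume
      ≤ ENNReal.ofReal (22 * m) ^ p.toReal⁻¹ := by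
  have hδ : 0 < Real.exp (-m) := Real.exp_pos _
  have hen (u : ℝ) : ‖(peak p.toReal⁻¹ c (Real.exp (-m)) u : ℂ)‖ₑ
      = ENNReal.ofReal (peak p.toReal⁻¹ c (Real.exp (-m)) u) := by
    rw [← ofReal_norm, Complex.norm_real, Real.norm_of_nonneg (peak_nonneg hδ u)]
  rcases eq_or_ne p ∞ with rfl | hpt
  · rw [eLpNorm_exponent_top]
    refine eLpNormEssSup_le_of_ae_enorm_bound (.of_forall fun u => ?_)
    rw [hen]
    simp only [peak, ENNReal.toReal_top, inv_zero, neg_zero, Real.rpow_zero, one_mul,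
      ENNReal.rpow_zero]
    exact ENNReal.ofReal_le_one.2 (cutoff_le_one u)
  have hr := ENNReal.toReal_pos hp hpt
  rw [eLpNorm_eq_lintegral_rpow_enorm_toReal hp hpt, one_div]
  refine ENNReal.rpow_le_rpow (le_trans ?_ (lintegral_inv_max_abs_le hc hm)) (by positivity)
  rw [← lintegral_indicator measurableSet_Icc]
  refine lintegral_mono fun u => ?_
  rw [hen]
  by_cases hu : u ∈ Set.Icc (-8 : ℝ) 8
  · rw [Set.indicator_of_mem hu, ENNReal.ofReal_rpow_of_nonneg (peak_nonneg hδ u) hr.le]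
    refine ENNReal.ofReal_le_ofReal ?_
    set M := max (Real.exp (-m)) |u - c| with hM
    have hM0 : 0 < M := hδ.trans_le (le_max_left _ _)
    rw [peak, Real.mul_rpow (Real.rpow_nonneg hM0.le _) (cutoff_nonneg u),
      ← Real.rpow_mul hM0.le, neg_mul, inv_mul_cancel₀ hr.ne', Real.rpow_neg_one]
    exact mul_le_of_le_one_right (by positivity)
      (Real.rpow_le_one (cutoff_nonneg u) (cutoff_le_one u) hr.le)
  · rw [Set.indicator_of_notMem hu, peak, cutoff_eq_zero hu]
    simp [hr]

theorem le_peak {a c δ ρ u : ℝ} (ha : 0 ≤ a) (hδ : 0 < δ) (h1 : δ ≤ ρ) (h2 : |u - c| ≤ ρ)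
    (hu : |u| ≤ 7) : ρ ^ (-a) ≤ peak a c δ u := by
  rw [peak, cutoff_eq_one hu, mul_one]
  exact Real.rpow_le_rpow_of_nonpos (hδ.trans_le (le_max_left _ _)) (max_le h1 h2) (by linarith)

theorem inv_le_rpow_mul_rpow {a b s : ℝ} (hb : 0 ≤ b) (hab : a + 2 * b = 1)
    (hs : 0 < s) : (3 * s)⁻¹ ≤ (3 * s) ^ (-a) * (3 * s ^ 2) ^ (-b) := by
  have h3 : 0 < 3 * s := by positivity
  calc (3 * s)⁻¹ = (3 * s) ^ (-a) * ((3 * s) ^ (2 : ℝ)) ^ (-b) := by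
        rw [← Real.rpow_mul h3.le, ← Real.rpow_add h3, ← Real.rpow_neg_one]
        congr 1; linarith
    _ ≤ _ := by
        refine mul_le_mul_of_nonneg_left ?_ (Real.rpow_nonneg h3.le _)
        refine Real.rpow_le_rpow_of_nonpos (by positivity) ?_ (by linarith)
        rw [Real.rpow_two]
        nlinarith [sq_nonneg s]

/-- At `s = t - t₀` the Lipschitz argument is within `O(s)` of its centre and the stationary one
within `O(s²)`, so `a + 2b = 1` makes the product at least `(3s)^{-1}`. Integrating over `(e^{-n},
1]` gives `n/3`. The shift `y`, of size at most `e^{-2n}`, is harmless at both scales. -/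
theorem le_lintegral_peak_mul_peak {a b t₀ : ℝ} (ha : 0 ≤ a) (hb : 0 ≤ b) (hab : a + 2 * b = 1)
    (ht₀ : 0 ≤ t₀) (ht₁ : t₀ + 1 ≤ 2 * Real.pi) {φ₁ φ₂ : ℝ → ℝ}
    (h1 : ∀ t, |φ₁ t - φ₁ t₀| ≤ 2 * |t - t₀|) (h2 : ∀ t, |φ₂ t - φ₂ t₀| ≤ 2 * (t - t₀) ^ 2)
    (hφ₁ : ∀ t, |φ₁ t| ≤ 2) (hφ₂ : ∀ t, |φ₂ t| ≤ 2) {n y : ℝ} (hn : 1 ≤ n)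
    (hy : |y| ≤ Real.exp (-(2 * n))) :
    ENNReal.ofReal (n / 3) ≤ ∫⁻ t, ENNReal.ofReal (peak a (φ₁ t₀) (Real.exp (-n)) (y + φ₁ t)) *
      ENNReal.ofReal (peak b (φ₂ t₀) (Real.exp (-(2 * n))) (y + φ₂ t)) ∂circ := by
  set ε := Real.exp (-n) with hε
  have hε0 : 0 < ε := Real.exp_pos _
  have hε1 : ε ≤ 1 := Real.exp_le_one_iff.2 (by linarith)
  have hε2 : Real.exp (-(2 * n)) = ε ^ 2 := by
    rw [hε, ← Real.exp_nat_mul]; congr 1; push_cast; ring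
  rw [hε2] at hy ⊢
  have hεε : ε ^ 2 ≤ ε := by nlinarith
  have lower : ∀ t ∈ Set.Ioc (t₀ + ε) (t₀ + 1), ENNReal.ofReal (3 * (t - t₀))⁻¹
      ≤ ENNReal.ofReal (peak a (φ₁ t₀) ε (y + φ₁ t)) *
        ENNReal.ofReal (peak b (φ₂ t₀) (ε ^ 2) (y + φ₂ t)) := by
    intro t ht
    have hs0 : ε < t - t₀ := by linarith [ht.1]
    have hs1 : t - t₀ ≤ 1 := by linarith [ht.2]
    have hspos : 0 < t - t₀ := hε0.trans hs0
    have hsq : ε ^ 2 ≤ (t - t₀) ^ 2 := pow_le_pow_left₀ hε0.le hs0.le 2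
    rw [← ENNReal.ofReal_mul (peak_nonneg hε0 _)]
    refine ENNReal.ofReal_le_ofReal ((inv_le_rpow_mul_rpow hb hab hspos).trans ?_)
    have hy1 : |y| ≤ 1 := by linarith
    have e1 := h1 t
    rw [abs_of_pos hspos] at e1
    refine mul_le_mul (le_peak ha hε0 (by linarith) ?_ ?_)
      (le_peak hb (by positivity) (by linarith [sq_nonneg (t - t₀)]) ?_ ?_)
      (Real.rpow_nonneg (by positivity) _) (peak_nonneg hε0 _)
    · rw [add_sub_assoc]
      exact (abs_add_le _ _).trans (by linarith)
    · exact (abs_add_le _ _).trans (by linarith [hφ₁ t])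
    · rw [add_sub_assoc]
      exact (abs_add_le _ _).trans (by linarith [h2 t])
    · exact (abs_add_le _ _).trans (by linarith [hφ₂ t])
  have hsub : Set.Ioc (t₀ + ε) (t₀ + 1) ⊆ Set.Ioc 0 (2 * Real.pi) := fun t ht =>
    ⟨by linarith [ht.1], ht.2.trans ht₁⟩
  have hint : ∫⁻ t in Set.Ioc (t₀ + ε) (t₀ + 1), ENNReal.ofReal (3 * (t - t₀))⁻¹
      = ENNReal.ofReal (n / 3) := by
    have hco : ContinuousOn (fun t : ℝ => (3 * (t - t₀))⁻¹) (Set.Icc (t₀ + ε) (t₀ + 1)) := by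
      refine ContinuousOn.inv₀ (by fun_prop) fun t ht => ?_
      have : 0 < t - t₀ := by linarith [ht.1]
      positivity
    rw [← ofReal_integral_eq_lintegral_ofReal (hco.integrableOn_Icc.mono_set Set.Ioc_subset_Icc_self)
      ((ae_restrict_iff' measurableSet_Ioc).2 (.of_forall fun t ht => ?_)),
      ← intervalIntegral.integral_of_le (by linarith)]
    · congr 1
      have := intervalIntegral.integral_comp_sub_right (a := t₀ + ε) (b := t₀ + 1)
        (fun s : ℝ => (3 * s)⁻¹) t₀
      rw [this, add_sub_cancel_left, add_sub_cancel_left]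
      simp only [mul_inv]
      rw [intervalIntegral.integral_const_mul, integral_inv_of_pos hε0 one_pos, one_div,
        Real.log_inv, hε, Real.log_exp]
      ring
    · have : 0 < t - t₀ := by linarith [ht.1]
      exact inv_nonneg.2 (by positivity)
  calc _ = ∫⁻ t in Set.Ioc (t₀ + ε) (t₀ + 1), ENNReal.ofReal (3 * (t - t₀))⁻¹ := hint.symm
    _ ≤ ∫⁻ t in Set.Ioc (t₀ + ε) (t₀ + 1), ENNReal.ofReal (peak a (φ₁ t₀) ε (y + φ₁ t)) *
        ENNReal.ofReal (peak b (φ₂ t₀) (ε ^ 2) (y + φ₂ t)) :=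
        setLIntegral_mono' measurableSet_Ioc lower
    _ ≤ _ := lintegral_mono_set hsub

theorem enorm_T_eq {g₁ g₂ : ℝ → ℝ} (c₁ : Continuous g₁) (c₂ : Continuous g₂) (h₁ : ∀ u, 0 ≤ g₁ u)
    (h₂ : ∀ u, 0 ≤ g₂ u) (x : ℝ) :
    ‖T (fun u => (g₁ u : ℂ)) (fun u => (g₂ u : ℂ)) x‖ₑ
      = posT (fun u => ENNReal.ofReal (g₁ u)) (fun u => ENNReal.ofReal (g₂ u)) x := by
  have hc : Continuous fun t => g₁ (x - Real.cos t) * g₂ (x - Real.sin t) :=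
    (c₁.comp (by fun_prop)).mul (c₂.comp (by fun_prop))
  have hnn (t : ℝ) : 0 ≤ g₁ (x - Real.cos t) * g₂ (x - Real.sin t) := mul_nonneg (h₁ _) (h₂ _)
  have hi : Integrable (fun t => g₁ (x - Real.cos t) * g₂ (x - Real.sin t)) circ :=
    hc.integrableOn_Ioc
  have e : T (fun u => (g₁ u : ℂ)) (fun u => (g₂ u : ℂ)) x
      = ((∫ t, g₁ (x - Real.cos t) * g₂ (x - Real.sin t) ∂circ : ℝ) : ℂ) := by
    rw [T, intervalIntegral.integral_of_le two_pi_pos_le, ← integral_complex_ofReal]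
    simp only [integrand, Complex.ofReal_mul]
  rw [e, ← ofReal_norm, Complex.norm_real, Real.norm_of_nonneg (integral_nonneg hnn),
    ofReal_integral_eq_lintegral_ofReal hi (.of_forall hnn), posT]
  exact lintegral_congr fun t => ENNReal.ofReal_mul (h₁ _)

/-- Dividing by `(44n)^{1-b}` would keep `(44n)^b` bounded. -/
theorem false_of_log_growth {b : ℝ} (hb : 0 < b) (C : ℝ≥0)
    (h : ∀ n : ℝ, 1 ≤ n → ENNReal.ofReal (n / 3) ≤ C * ENNReal.ofReal (44 * n) ^ (1 - b)) :
    False := by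
  have key (n : ℝ) (hn : 1 ≤ n) : (44 * n) ^ b ≤ 132 * C := by
    have h44 : 0 < 44 * n := by positivity
    have h0 := h n hn
    rw [ENNReal.ofReal_rpow_of_pos h44, ← ENNReal.ofReal_coe_nnreal,
      ← ENNReal.ofReal_mul C.coe_nonneg, ENNReal.ofReal_le_ofReal_iff
        (mul_nonneg C.coe_nonneg (Real.rpow_nonneg h44.le _))] at h0
    have hpos : 0 < (44 * n) ^ (1 - b) := Real.rpow_pos_of_pos h44 _
    have e : (44 * n) ^ b * (44 * n) ^ (1 - b) = 44 * n := by
      rw [← Real.rpow_add h44]; simp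
    refine le_of_mul_le_mul_right ?_ hpos
    rw [e]
    linarith
  have lim : Filter.Tendsto (fun n : ℝ => (44 * n) ^ b) Filter.atTop Filter.atTop :=
    (tendsto_rpow_atTop hb).comp (Filter.tendsto_id.const_mul_atTop (by norm_num))
  obtain ⟨n, hn1, hn2⟩ :=
    ((lim.eventually_gt_atTop (132 * C : ℝ)).and (Filter.eventually_ge_atTop 1)).exists
  exact absurd (key n hn2) (not_le.2 hn1)

theorem eLpNorm_peak_mul_eLpNorm_peak_le {p q : ℝ≥0∞} (hp : p ≠ 0) (hq : q ≠ 0)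
    (h : p.toReal⁻¹ + 2 * q.toReal⁻¹ = 1) {c d n : ℝ} (hc : |c| ≤ 2) (hd : |d| ≤ 2) (hn : 1 ≤ n) :
    eLpNorm (fun u => (peak p.toReal⁻¹ c (Real.exp (-n)) u : ℂ)) p volume *
      eLpNorm (fun u => (peak q.toReal⁻¹ d (Real.exp (-(2 * n))) u : ℂ)) q volume
      ≤ ENNReal.ofReal (44 * n) ^ (1 - q.toReal⁻¹) := by
  have ha : 0 ≤ p.toReal⁻¹ := inv_nonneg.2 ENNReal.toReal_nonneg
  have hb : 0 ≤ q.toReal⁻¹ := inv_nonneg.2 ENNReal.toReal_nonneg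
  calc _ ≤ ENNReal.ofReal (22 * n) ^ p.toReal⁻¹ * ENNReal.ofReal (22 * (2 * n)) ^ q.toReal⁻¹ :=
        mul_le_mul' (eLpNorm_peak_le hp hc hn) (eLpNorm_peak_le hq hd (by linarith))
    _ ≤ ENNReal.ofReal (44 * n) ^ p.toReal⁻¹ * ENNReal.ofReal (44 * n) ^ q.toReal⁻¹ := by
        refine mul_le_mul' (ENNReal.rpow_le_rpow (ENNReal.ofReal_le_ofReal ?_) ha)
          (ENNReal.rpow_le_rpow (ENNReal.ofReal_le_ofReal ?_) hb) <;> linarith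
    _ = _ := by
        rw [← ENNReal.rpow_add_of_nonneg _ _ ha hb]
        congr 1; linarith

/-! ### Failure of strong type for `r = ∞` -/

theorem abs_cos_sub_cos_le (s t : ℝ) : |Real.cos s - Real.cos t| ≤ |s - t| := by
  simpa [Real.dist_eq] using Real.lipschitzWith_cos.dist_le_mul s t

theorem abs_sin_sub_sin_le (s t : ℝ) : |Real.sin s - Real.sin t| ≤ |s - t| := by
  simpa [Real.dist_eq] using Real.lipschitzWith_sin.dist_le_mul s t

theorem abs_cos_sub_one_le (s : ℝ) : |Real.cos s - 1| ≤ s ^ 2 := by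
  have h1 := Real.one_sub_sq_div_two_le_cos (x := s)
  have h2 := Real.cos_le_one s
  rw [abs_le]
  constructor <;> nlinarith [sq_nonneg s]

theorem abs_sin_sub_sin_pi_div_two_le (t : ℝ) :
    |Real.sin t - Real.sin (Real.pi / 2)| ≤ 2 * (t - Real.pi / 2) ^ 2 := by
  have := abs_cos_sub_one_le (t - Real.pi / 2)
  rw [Real.cos_sub_pi_div_two] at this
  rw [Real.sin_pi_div_two]
  linarith [sq_nonneg (t - Real.pi / 2)]

theorem sqrt_two_le_two : √2 ≤ 2 := Real.sqrt_le_iff.2 (by norm_num)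

theorem sin_sub_cos_eq (t : ℝ) :
    Real.sin t - Real.cos t = √2 * Real.cos (t - 3 * Real.pi / 4) := by
  rw [← phase_sqrt_two_five_pi_div_four, phase]
  congr 1
  rw [show t + (Real.pi / 4 + Real.pi) = t - 3 * Real.pi / 4 + 2 * Real.pi by ring,
    Real.cos_add_two_pi]

theorem abs_sin_sub_cos_le (t : ℝ) : |Real.sin t - Real.cos t| ≤ 2 := by
  rw [sin_sub_cos_eq, abs_mul, abs_of_nonneg (Real.sqrt_nonneg 2)]
  nlinarith [sqrt_two_le_two, Real.abs_cos_le_one (t - 3 * Real.pi / 4), Real.sqrt_nonneg 2]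

theorem abs_sin_sub_cos_sub_le (t : ℝ) :
    |(Real.sin t - Real.cos t) - (Real.sin (3 * Real.pi / 4) - Real.cos (3 * Real.pi / 4))|
      ≤ 2 * (t - 3 * Real.pi / 4) ^ 2 := by
  rw [sin_sub_cos_eq, sin_sub_cos_eq, sub_self, Real.cos_zero, ← mul_sub, abs_mul,
    abs_of_nonneg (Real.sqrt_nonneg 2)]
  exact mul_le_mul sqrt_two_le_two (abs_cos_sub_one_le _) (abs_nonneg _) (by norm_num)

theorem toReal_inv_nonneg (p : ℝ≥0∞) : 0 ≤ p.toReal⁻¹ := inv_nonneg.2 ENNReal.toReal_nonneg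

theorem pi_div_two_add_one_le : Real.pi / 2 + 1 ≤ 2 * Real.pi := by
  linarith [Real.pi_gt_three]

theorem not_isStrongTypeOnTest_top {p q : ℝ≥0∞} (hp : p ≠ 0) (hq : q ≠ 0) (hq' : q ≠ ∞)
    (h : p.toReal⁻¹ + 2 * q.toReal⁻¹ = 1) : ¬ IsStrongTypeOnTest p q ∞ := by
  rintro ⟨C, hC⟩
  refine false_of_log_growth (inv_pos.2 (ENNReal.toReal_pos hq hq')) C fun n hn => ?_
  have e1 : 0 < Real.exp (-n) := Real.exp_pos _
  have e2 : 0 < Real.exp (-(2 * n)) := Real.exp_pos _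
  -- At `t₀ = π/2` sine is stationary while cosine is not, so `f₂` carries the quadratic
  -- singularity.
  set c := - Real.cos (Real.pi / 2) with hc
  set d := - Real.sin (Real.pi / 2) with hd
  have hcle : |c| ≤ 2 := by rw [hc, abs_neg]; linarith [Real.abs_cos_le_one (Real.pi / 2)]
  have hdle : |d| ≤ 2 := by rw [hd, abs_neg]; linarith [Real.abs_sin_le_one (Real.pi / 2)]
  set F := peak p.toReal⁻¹ c (Real.exp (-n))
  set G := peak q.toReal⁻¹ d (Real.exp (-(2 * n)))
  have cF : Continuous F := continuous_peak e1
  have cG : Continuous G := continuous_peak e2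
  have hTb := hC (fun u => (F u : ℂ)) (fun u => (G u : ℂ)) (by fun_prop)
    (hasCompactSupport_peak _ _ _) (by fun_prop) (hasCompactSupport_peak _ _ _)
  rw [mul_assoc] at hTb
  refine le_trans ?_ (hTb.trans (mul_le_mul' le_rfl
    (eLpNorm_peak_mul_eLpNorm_peak_le hp hq h hcle hdle hn)))
  have low (y : ℝ) (hy : |y| ≤ Real.exp (-(2 * n))) :
      ENNReal.ofReal (n / 3) ≤ ‖T (fun u => (F u : ℂ)) (fun u => (G u : ℂ)) y‖ₑ := by
    rw [enorm_T_eq cF cG (peak_nonneg e1) (peak_nonneg e2)]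
    exact le_lintegral_peak_mul_peak (toReal_inv_nonneg p) (toReal_inv_nonneg q) h
      (by positivity) pi_div_two_add_one_le
      (φ₁ := fun t => - Real.cos t) (φ₂ := fun t => - Real.sin t)
      (fun t => by
        rw [neg_sub_neg, abs_sub_comm]
        linarith [abs_cos_sub_cos_le t (Real.pi / 2), abs_nonneg (t - Real.pi / 2)])
      (fun t => by
        rw [neg_sub_neg, abs_sub_comm]
        exact abs_sin_sub_sin_pi_div_two_le t)
      (fun t => by rw [abs_neg]; linarith [Real.abs_cos_le_one t])
      (fun t => by rw [abs_neg]; linarith [Real.abs_sin_le_one t]) hn hy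
  rw [eLpNorm_exponent_top]
  -- The lower bound holds on an interval of positive length, so it passes to the essential
  -- supremum.
  by_contra! hlt
  have hnull := meas_eLpNormEssSup_lt (μ := volume)
    (f := T (fun u => (F u : ℂ)) (fun u => (G u : ℂ)))
  have hsub : Set.Icc (-Real.exp (-(2 * n))) (Real.exp (-(2 * n))) ⊆
      {y | eLpNormEssSup (T (fun u => (F u : ℂ)) (fun u => (G u : ℂ))) volume
        < ‖T (fun u => (F u : ℂ)) (fun u => (G u : ℂ)) y‖ₑ} := fun y hy =>
    hlt.trans_le (low y (abs_le.2 hy))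
  have := measure_mono_null hsub hnull
  rw [Real.volume_Icc, ENNReal.ofReal_eq_zero] at this
  linarith

/-! ### Failure of strong type for `p₂ = 1` -/

theorem tent_nonneg (δ u : ℝ) : 0 ≤ tent δ u := le_max_left _ _

theorem continuous_tent (δ : ℝ) : Continuous (tent δ) := by unfold tent; fun_prop

theorem tent_eq_zero {δ u : ℝ} (h : u ∉ Set.Icc (-δ) δ) : tent δ u = 0 := by
  have : δ < |u| := by
    by_contra hc
    exact h (abs_le.1 (not_lt.1 hc))
  rw [tent, max_eq_left (by linarith)]

theorem hasCompactSupport_tent (δ : ℝ) : HasCompactSupport fun u => (tent δ u : ℂ) :=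
  HasCompactSupport.intro isCompact_Icc fun u hu => by rw [tent_eq_zero hu, Complex.ofReal_zero]

theorem eLpNorm_tent_ne_zero {δ : ℝ} (hδ : 0 < δ) :
    eLpNorm (fun u => (tent δ u : ℂ)) 1 volume ≠ 0 := by
  have hc : Continuous fun u => (tent δ u : ℂ) := Complex.continuous_ofReal.comp (continuous_tent δ)
  rw [Ne, eLpNorm_eq_zero_iff hc.aestronglyMeasurable one_ne_zero]
  intro h
  have h0 := congrFun ((Continuous.ae_eq_iff_eq volume hc continuous_const).1 h) 0
  have h1 : tent δ 0 = 0 := Complex.ofReal_eq_zero.1 h0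
  rw [tent, abs_zero, sub_zero, max_eq_right hδ.le] at h1
  exact hδ.ne' h1

theorem eLpNorm_tent_ne_top (δ : ℝ) : eLpNorm (fun u => (tent δ u : ℂ)) 1 volume ≠ ∞ := by
  have hc : Continuous fun u => (tent δ u : ℂ) := Complex.continuous_ofReal.comp (continuous_tent δ)
  exact (hc.memLp_of_hasCompactSupport (hasCompactSupport_tent δ)).2.ne

/-- The tent acts as a delta for `f₂`: centred there, the form only sees `|y| ≤ e^{-2n}`, and the
tent's mass `J` cancels. Hölder in `r` and `q` leaves a bilinear inequality for `F` and `H`. -/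
theorem not_isStrongTypeOnTest_one {p q r : ℝ≥0∞} (hrq : r⁻¹ + q⁻¹ = 1) {b : ℝ} (hb : 0 < b)
    (h : ∀ n : ℝ, 1 ≤ n → ∃ F H : ℝ → ℝ, Continuous F ∧ HasCompactSupport (fun u => (F u : ℂ)) ∧
      Continuous H ∧ (∀ u, 0 ≤ F u) ∧ (∀ u, 0 ≤ H u) ∧
      eLpNorm (fun u => (F u : ℂ)) p volume * eLpNorm (fun u => (H u : ℂ)) q volume
        ≤ ENNReal.ofReal (44 * n) ^ (1 - b) ∧
      ∀ y, |y| ≤ Real.exp (-(2 * n)) → ENNReal.ofReal (n / 3) ≤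
        ∫⁻ t, ENNReal.ofReal (F (y + (Real.sin t - Real.cos t))) *
          ENNReal.ofReal (H (y + Real.sin t)) ∂circ) :
    ¬ IsStrongTypeOnTest p 1 r := by
  rintro ⟨C, hC⟩
  refine false_of_log_growth hb C fun n hn => ?_
  obtain ⟨F, H, cF, sF, cH, nF, nH, hnorm, hlow⟩ := h n hn
  set δ := Real.exp (-(2 * n)) with hδ
  have hδ0 : 0 < δ := Real.exp_pos _
  set J := eLpNorm (fun u => (tent δ u : ℂ)) 1 volume with hJ
  have hJe : J = ∫⁻ u, ENNReal.ofReal (tent δ u) := by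
    rw [hJ, eLpNorm_one_eq_lintegral_enorm]
    refine lintegral_congr fun u => ?_
    rw [← ofReal_norm, Complex.norm_real, Real.norm_of_nonneg (tent_nonneg δ u)]
  have cG : Continuous (tent δ) := continuous_tent δ
  set τ := T (fun u => (F u : ℂ)) (fun u => (tent δ u : ℂ)) with hτ
  have hTb : eLpNorm τ r volume ≤ C * eLpNorm (fun u => (F u : ℂ)) p volume * J :=
    hC (fun u => (F u : ℂ)) (fun u => (tent δ u : ℂ)) (by fun_prop) sF (by fun_prop)
      (hasCompactSupport_tent δ)
  have hτe (x : ℝ) : ‖τ x‖ₑ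
      = posT (fun u => ENNReal.ofReal (F u)) (fun u => ENNReal.ofReal (tent δ u)) x :=
    enorm_T_eq cF cG nF (tent_nonneg δ) x
  have mτ : AEStronglyMeasurable τ volume := by
    have hm : Measurable (Function.uncurry
        (integrand (fun u => (F u : ℂ)) fun u => (tent δ u : ℂ))) := by
      have := cF.measurable
      have := cG.measurable
      unfold Function.uncurry integrand; fun_prop
    have : τ = fun x => ∫ t, integrand (fun u => (F u : ℂ)) (fun u => (tent δ u : ℂ)) x t ∂circ := by
      funext x
      rw [hτ, T, intervalIntegral.integral_of_le two_pi_pos_le]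
    rw [this]
    exact (hm.stronglyMeasurable.integral_prod_right').aestronglyMeasurable
  have hholder : ∫⁻ x, ‖τ x‖ₑ * ENNReal.ofReal (H x)
      ≤ eLpNorm τ r volume * eLpNorm (fun u => (H u : ℂ)) q volume := by
    have : ENNReal.HolderTriple r q 1 := ⟨by rw [hrq, inv_one]⟩
    have hs := eLpNorm_smul_le_mul_eLpNorm (p := r) (q := q) (r := 1)
      (f := fun u => (H u : ℂ)) (by fun_prop : Continuous fun u => (H u : ℂ)).aestronglyMeasurable
      mτ
    rw [eLpNorm_one_eq_lintegral_enorm] at hs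
    refine le_trans (le_of_eq (lintegral_congr fun x => ?_)) hs
    rw [Pi.smul_apply', smul_eq_mul, enorm_mul, ← ofReal_norm (H x : ℂ), Complex.norm_real,
      Real.norm_of_nonneg (nH x)]
  have hlower : ENNReal.ofReal (n / 3) * J ≤ ∫⁻ x, ‖τ x‖ₑ * ENNReal.ofReal (H x) := by
    have := cF.measurable
    have := cG.measurable
    have := cH.measurable
    simp_rw [hτe]
    rw [lintegral_posT_mul' (by fun_prop) (by fun_prop) (by fun_prop), hJe,
      ← lintegral_const_mul _ (by fun_prop)]
    refine lintegral_mono fun y => ?_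
    by_cases hy : y ∈ Set.Icc (-δ) δ
    · rw [mul_comm]
      exact mul_le_mul' le_rfl (hlow y (abs_le.2 hy))
    · rw [tent_eq_zero hy]; simp
  refine (ENNReal.mul_le_mul_iff_left (eLpNorm_tent_ne_zero hδ0) (eLpNorm_tent_ne_top δ)).1 ?_
  calc ENNReal.ofReal (n / 3) * J ≤ eLpNorm τ r volume * eLpNorm (fun u => (H u : ℂ)) q volume :=
        hlower.trans hholder
    _ ≤ C * eLpNorm (fun u => (F u : ℂ)) p volume * J * eLpNorm (fun u => (H u : ℂ)) q volume :=
        mul_le_mul' hTb le_rfl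
    _ = C * (eLpNorm (fun u => (F u : ℂ)) p volume * eLpNorm (fun u => (H u : ℂ)) q volume) * J := by
        ring
    _ ≤ _ := by gcongr

/-- Here `F` carries the stronger singularity: its argument `sin t - cos t` is maximal at `3π/4`,
where `sin` is not stationary. This serves P and G. -/
theorem not_isStrongTypeOnTest_of_left {p q r : ℝ≥0∞} (hrq : r⁻¹ + q⁻¹ = 1) (hp : p ≠ 0)
    (hp' : p ≠ ∞) (hq : q ≠ 0) (h : q.toReal⁻¹ + 2 * p.toReal⁻¹ = 1) :
    ¬ IsStrongTypeOnTest p 1 r := by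
  refine not_isStrongTypeOnTest_one hrq (inv_pos.2 (ENNReal.toReal_pos hp hp')) fun n hn => ?_
  have e1 : 0 < Real.exp (-n) := Real.exp_pos _
  have e2 : 0 < Real.exp (-(2 * n)) := Real.exp_pos _
  refine ⟨peak p.toReal⁻¹ (Real.sin (3 * Real.pi / 4) - Real.cos (3 * Real.pi / 4))
    (Real.exp (-(2 * n))), peak q.toReal⁻¹ (Real.sin (3 * Real.pi / 4)) (Real.exp (-n)),
    continuous_peak e2, hasCompactSupport_peak _ _ _, continuous_peak e1, peak_nonneg e2,
    peak_nonneg e1, ?_, fun y hy => ?_⟩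
  · rw [mul_comm]
    exact eLpNorm_peak_mul_eLpNorm_peak_le hq hp h
      (by linarith [Real.abs_sin_le_one (3 * Real.pi / 4)]) (abs_sin_sub_cos_le _) hn
  · refine (le_lintegral_peak_mul_peak (toReal_inv_nonneg q) (toReal_inv_nonneg p) h
      (t₀ := 3 * Real.pi / 4) (by positivity) (by linarith [Real.pi_gt_three])
      (φ₁ := Real.sin) (φ₂ := fun t => Real.sin t - Real.cos t)
      (fun t => by
        linarith [abs_sin_sub_sin_le t (3 * Real.pi / 4), abs_nonneg (t - 3 * Real.pi / 4)])
      abs_sin_sub_cos_sub_le (fun t => by linarith [Real.abs_sin_le_one t])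
      abs_sin_sub_cos_le hn hy).trans_eq ?_
    exact lintegral_congr fun t => mul_comm _ _

/-- Here the dual function `H` carries the stronger singularity, at the maximum `π/2` of its
argument `sin t`. This serves K, where `p = ∞` leaves `F` without singularity. -/
theorem not_isStrongTypeOnTest_of_right {p q r : ℝ≥0∞} (hrq : r⁻¹ + q⁻¹ = 1) (hp : p ≠ 0)
    (hq : q ≠ 0) (hq' : q ≠ ∞) (h : p.toReal⁻¹ + 2 * q.toReal⁻¹ = 1) :
    ¬ IsStrongTypeOnTest p 1 r := by
  refine not_isStrongTypeOnTest_one hrq (inv_pos.2 (ENNReal.toReal_pos hq hq')) fun n hn => ?_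
  have e1 : 0 < Real.exp (-n) := Real.exp_pos _
  have e2 : 0 < Real.exp (-(2 * n)) := Real.exp_pos _
  refine ⟨peak p.toReal⁻¹ (Real.sin (Real.pi / 2) - Real.cos (Real.pi / 2)) (Real.exp (-n)),
    peak q.toReal⁻¹ (Real.sin (Real.pi / 2)) (Real.exp (-(2 * n))),
    continuous_peak e1, hasCompactSupport_peak _ _ _, continuous_peak e2, peak_nonneg e1,
    peak_nonneg e2, ?_, fun y hy => ?_⟩
  · exact eLpNorm_peak_mul_eLpNorm_peak_le hp hq h (abs_sin_sub_cos_le _)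
      (by linarith [Real.abs_sin_le_one (Real.pi / 2)]) hn
  · exact le_lintegral_peak_mul_peak (toReal_inv_nonneg p) (toReal_inv_nonneg q) h
      (by positivity) pi_div_two_add_one_le
      (φ₁ := fun t => Real.sin t - Real.cos t) (φ₂ := Real.sin)
      (fun t => by
        rw [sub_sub_sub_comm]
        refine (abs_sub _ _).trans ?_
        linarith [abs_sin_sub_sin_le t (Real.pi / 2), abs_cos_sub_cos_le t (Real.pi / 2)])
      abs_sin_sub_sin_pi_div_two_le abs_sin_sub_cos_le
      (fun t => by linarith [Real.abs_sin_le_one t]) hn hy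

/-! ### Failure at the individual points and on the segment -/

theorem not_isStrongTypeOnTest_P : ¬ IsStrongTypeOnTest 2 1 1 :=
  not_isStrongTypeOnTest_of_left (q := ∞) (by simp) (by simp) (by simp) (by simp) (by simp)

theorem not_isStrongTypeOnTest_G : ¬ IsStrongTypeOnTest 3 1 (3 / 2) := by
  refine not_isStrongTypeOnTest_of_left (q := 3) ?_ (by simp) (by simp) (by simp)
    (by rw [ENNReal.toReal_ofNat]; norm_num)
  rw [ENNReal.inv_div (by simp) (by simp), ← one_div, ← ENNReal.add_div,
    show (2 + 1 : ℝ≥0∞) = 3 by norm_num]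
  exact ENNReal.div_self (by simp) (by simp)

theorem not_isStrongTypeOnTest_K : ¬ IsStrongTypeOnTest ∞ 1 2 :=
  not_isStrongTypeOnTest_of_right (q := 2) ENNReal.inv_two_add_inv_two (by simp) (by simp) (by simp)
    (by simp)

theorem not_isStrongTypeOnTest_E : ¬ IsStrongTypeOnTest ∞ 2 ∞ :=
  not_isStrongTypeOnTest_top (by simp) (by simp) (by simp) (by simp)

theorem not_isStrongTypeOnTest_B : ¬ IsStrongTypeOnTest 3 3 ∞ :=
  not_isStrongTypeOnTest_top (by simp) (by simp) (by simp)
    (by rw [ENNReal.toReal_ofNat]; norm_num)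

/-- The line through B and E is `1/p₁ + 2/p₂ = 1`, exactly the balance that produces the logarithm.
-/
theorem not_isStrongTypeOnTest_segment {p₁ p₂ : ℝ}
    (h : (p₁⁻¹, p₂⁻¹) ∈ openSegment ℝ ((1 / 3 : ℝ), (1 / 3 : ℝ)) ((0 : ℝ), (1 / 2 : ℝ))) :
    ¬ IsStrongTypeOnTest (ENNReal.ofReal p₁) (ENNReal.ofReal p₂) ∞ := by
  obtain ⟨a, b, ha, hb, hab, he⟩ := h
  simp only [Prod.smul_mk, smul_eq_mul, Prod.mk_add_mk, Prod.mk.injEq] at he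
  obtain ⟨he1, he2⟩ := he
  have h1 : 0 < p₁ := inv_pos.1 (by rw [← he1]; linarith)
  have h2 : 0 < p₂ := inv_pos.1 (by rw [← he2]; linarith)
  refine not_isStrongTypeOnTest_top (by simpa using h1) (by simpa using h2) (by simp) ?_
  rw [ENNReal.toReal_ofReal h1.le, ENNReal.toReal_ofReal h2.le, ← he1, ← he2]
  linarith

end CircularBilinear

open CircularBilinear in
/-- Exponents `(p₁, p₂, r)` of the points `(1/p₁, 1/p₂; 1/r)`:
`O = (0,0;0)`, `C = (0,1;1)`, `M = (3/5,3/5;2/5)`, `P = (1/2,1;1)`, `G = (1/3,1;2/3)`,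
`E = (0,1/2;0)`, `B = (1/3,1/3;0)`, `K = (0,1;1/2)`. -/
theorem mainTheorem2 :
    -- strong type at `O`, `C`, `M`
    (IsStrongType ∞ ∞ ∞ ∧ IsStrongType ∞ 1 1 ∧ IsStrongType (5 / 3) (5 / 3) (5 / 2)) ∧
    -- restricted type at `P`, `G`, `E`, `B`
    (IsRestrictedType 2 1 1 ∧ IsRestrictedType 3 1 (3 / 2) ∧
      IsRestrictedType ∞ 2 ∞ ∧ IsRestrictedType 3 3 ∞) ∧
    -- failure of strong type at `P`, `G`, `E`, `B`
    (¬ IsStrongTypeOnTest 2 1 1 ∧ ¬ IsStrongTypeOnTest 3 1 (3 / 2) ∧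
      ¬ IsStrongTypeOnTest ∞ 2 ∞ ∧ ¬ IsStrongTypeOnTest 3 3 ∞) ∧
    -- weak type, but not strong type, at `K`
    (IsWeakType ∞ 1 2 ∧ ¬ IsStrongTypeOnTest ∞ 1 2) ∧
    -- failure of strong type on the open segment `BE`
    (∀ p₁ p₂ : ℝ,
      (p₁⁻¹, p₂⁻¹) ∈ openSegment ℝ ((1 / 3 : ℝ), (1 / 3 : ℝ)) ((0 : ℝ), (1 / 2 : ℝ)) →
        ¬ IsStrongTypeOnTest (ENNReal.ofReal p₁) (ENNReal.ofReal p₂) ∞) := by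
  exact ⟨⟨isStrongType_O, isStrongType_C, isStrongType_M⟩,
    ⟨isRestrictedType_P, isRestrictedType_G, isRestrictedType_E, isRestrictedType_B⟩,
    ⟨not_isStrongTypeOnTest_P, not_isStrongTypeOnTest_G, not_isStrongTypeOnTest_E,
      not_isStrongTypeOnTest_B⟩,
    ⟨isWeakType_K, not_isStrongTypeOnTest_K⟩,
    fun _ _ h => not_isStrongTypeOnTest_segment h⟩
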